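/- Identify distributions on $\{-1,+1\}^V$, for a finite index set $V$, with probability mass functions; $\Omega(\cdot)$ denotes the support. For $\Lambda\subseteq V$ let $\mu_\Lambda$ be the marginal of $\mu$ on $\Lambda$ (and $\mu_i=\mu_{\{i\}}$), and for $\sigma\in\Omega(\mu_\Lambda)$ let $\mu^\sigma$ be $\mu$ conditioned on agreeing with $\sigma$ on $\Lambda$. For $\boldsymbol\lambda\in\mathbb R_{>0}^V$ let $\boldsymbol\lambda*\mu$ be the distribution with $(\boldsymbol\lambda*\mu)(\sigma)\propto\mu(\sigma)\prod_{i:\sigma_i=+1}\lambda_i$. *Spectral independence.* The absolute influence matrix of $\mu$ is $\Psi_\mu(i,j)=\max_{x,y\in\Omega(\mu_i)} d_{\mathrm{TV}}\big(\mu_j^{i\leftarrow x},\mu_j^{i\leftarrow y}\big)$ for $i,j\in V$. $\mu$ is $\eta$-spectrally independent if the spectral radius of $\Psi_{\mu^\sigma}$ is at most $\eta$ for all $\Lambda\subseteq V$ and $\sigma\in\Omega(\mu_\Lambda)$. (For the diagonal entries $\Psi_\mu(i,i)$ two conventions are in use: the same formula, or $\Psi_\mu(i,i)=0$. The lemma is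 claimed for each of the two, the same one being used in hypothesis and conclusion.) *Marginal stability.* $\mu$ is $\zeta$-marginally stable if for all $i\in V$, all $S\subseteq\Lambda\subseteq V\setminus\{i\}$ and all $\sigma\in\Omega(\mu_\Lambda)$ we have $R_i^\sigma\le\zeta$ and $R_i^\sigma\le\zeta\, R_i^{\sigma_S}$, where $\sigma_S$ is the restriction of $\sigma$ to $S$ and $R_i^\sigma=\mu_i^\sigma(+1)/\mu_i^\sigma(-1)\in[0,\infty]$. *$k$-transformation.* For an integer $k\ge1$, $\mu_k$ is the distribution on $\{-1,+1\}^{V\times[k]}$ of the following $Y$. Draw $X\sim\mu$ and, for each $i\in V$, an independent uniform $j_i\in[k]$; set $Y_{(i,j)}=+1$ if $X_i=+1$ and $j=j_i$, and $Y_{(i,j)}=-1$ otherwise. **Lemma.** Let $\eta>1$, $\epsilon>0$, $\zeta>1$, let $n \ge 0$, and let $\mu$ be a distribution on $\{-1,+1\}^n$ such that 1. $\boldsymbol\lambda*\mu$ is $\eta$-spectrally independent for all $\boldsymbol\lambda\in(0,1+\epsilon]^n$, and 2. $\boldsymbol\lambda*\mu$ is $\zeta$-marginally stable for all $\boldsymbol\lambda\in(0,1]^n$.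 Then for every integer $k\ge 10(1+\epsilon)(1+\zeta)$ the distribution $\mu_k$ satisfies, with $\eta'=2\eta+5>1$, $\epsilon'=\epsilon>0$ and $\zeta'=2\zeta>1$: 1. $\boldsymbol\lambda*\mu_k$ is $\eta'$-spectrally independent for all $\boldsymbol\lambda\in(0,1+\epsilon']^{[n]\times[k]}$, and 2. $\mu_k$ is $\zeta'$-marginally stable. -/

import Mathlib

open scoped ENNReal

noncomputable section

namespace SpinDist

/-! A spin is a `Bool`: `true` is the spin `+1` and `false` is the spin `-1`.
A distribution over `{-1,+1}^ι` is a `PMF (ι → Bool)`, and `Ω(μ)` is `μ.support`. -/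

variable {ι : Type*}

/-- The marginal distribution `μ_i` of the spin at `i`. -/
def marginal (μ : PMF (ι → Bool)) (i : ι) : PMF Bool :=
  μ.map fun x => x i

/-- The marginal distribution `μ_Λ` on a set `Λ` of coordinates. -/
def marginalOn (μ : PMF (ι → Bool)) (Λ : Finset ι) : PMF (Λ → Bool) :=
  μ.map Λ.restrict

theorem exists_of_mem_marginalOn {μ : PMF (ι → Bool)} {Λ : Finset ι} {σ : Λ → Bool}
    (hσ : σ ∈ (marginalOn μ Λ).support) :
    ∃ x ∈ {x : ι → Bool | Λ.restrict x = σ}, x ∈ μ.support := by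
  obtain ⟨x, hx, h⟩ := (PMF.mem_support_map_iff _ _ _).1 hσ
  exact ⟨x, h, hx⟩

theorem exists_of_mem_marginal {μ : PMF (ι → Bool)} {i : ι} {c : Bool}
    (hc : c ∈ (marginal μ i).support) :
    ∃ x ∈ {x : ι → Bool | x i = c}, x ∈ μ.support := by
  obtain ⟨x, hx, h⟩ := (PMF.mem_support_map_iff _ _ _).1 hc
  exact ⟨x, h, hx⟩

theorem restrict₂_mem_marginalOn {μ : PMF (ι → Bool)} {S Λ : Finset ι} (hS : S ⊆ Λ)
    {σ : Λ → Bool} (hσ : σ ∈ (marginalOn μ Λ).support) :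
    Finset.restrict₂ (π := fun _ => Bool) hS σ ∈ (marginalOn μ S).support := by
  obtain ⟨x, h, hx⟩ := exists_of_mem_marginalOn hσ
  refine (PMF.mem_support_map_iff _ _ _).2 ⟨x, hx, ?_⟩
  have h' : Λ.restrict x = σ := h
  rw [← h']
  rfl

/-- The conditional distribution `μ^σ` on all coordinates, for a pinning `σ ∈ Ω(μ_Λ)`. -/
def pin (μ : PMF (ι → Bool)) {Λ : Finset ι} (σ : Λ → Bool)
    (hσ : σ ∈ (marginalOn μ Λ).support) : PMF (ι → Bool) :=
  μ.filter {x | Λ.restrict x = σ} (exists_of_mem_marginalOn hσ)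

/-- The conditional distribution `μ^{i ← c}` for a spin `c ∈ Ω(μ_i)`. -/
def pinAt (μ : PMF (ι → Bool)) (i : ι) (c : Bool)
    (hc : c ∈ (marginal μ i).support) : PMF (ι → Bool) :=
  μ.filter {x | x i = c} (exists_of_mem_marginal hc)

/-- Total variation distance between two distributions on a finite type. -/
def tvDist {α : Type*} [Fintype α] (p q : PMF α) : ℝ :=
  (1 / 2) * ∑ a, |(p a).toReal - (q a).toReal|

/-- The maximal influence of the spin at `i` on the spin at `j`: the maximum over `x, y ∈ Ω(μ_i)`
of the total variation distance between `μ_j^{i ← x}` and `μ_j^{i ← y}`; the supremum ranges over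
a finite nonempty set, so it is a maximum. -/
def maxInfluence (μ : PMF (ι → Bool)) (i j : ι) : ℝ :=
  ⨆ (x : (marginal μ i).support) (y : (marginal μ i).support),
    tvDist (marginal (pinAt μ i x.1 x.2) j) (marginal (pinAt μ i y.1 y.2) j)

/-- The two conventions in use for the diagonal of the absolute influence matrix: either the
general formula is also applied to the entries `(i, i)`, or these entries are `0`. -/
inductive Diagonal where
  | formula
  | zero

/-- The absolute influence matrix `Ψ_μ`, with either convention for its diagonal. -/
def influence [DecidableEq ι] (d : Diagonal) (μ : PMF (ι → Bool)) : Matrix ι ι ℝ :=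
  match d with
  | .formula => fun i j => maxInfluence μ i j
  | .zero => fun i j => if i = j then 0 else maxInfluence μ i j

/-- `μ` is `η`-spectrally independent: the spectral radius (the largest modulus of a complex
eigenvalue) of `Ψ_{μ^σ}` is at most `η` for every pinning `σ`. -/
def SpectrallyIndependent [Fintype ι] [DecidableEq ι] (d : Diagonal) (η : ℝ)
    (μ : PMF (ι → Bool)) : Prop :=
  ∀ (Λ : Finset ι) (σ : Λ → Bool) (hσ : σ ∈ (marginalOn μ Λ).support),
    spectralRadius ℂ ((influence d (pin μ σ hσ)).map Complex.ofReal) ≤ ENNReal.ofReal η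

/-- The marginal ratio `μ_i(+1) / μ_i(-1)`, which is `∞` if `μ_i(-1) = 0`. -/
def marginalRatio (μ : PMF (ι → Bool)) (i : ι) : ℝ≥0∞ :=
  marginal μ i true / marginal μ i false

/-- `μ` is `ζ`-marginally stable. -/
def MarginallyStable (ζ : ℝ) (μ : PMF (ι → Bool)) : Prop :=
  ∀ (i : ι) (S Λ : Finset ι) (hS : S ⊆ Λ), i ∉ Λ →
    ∀ (σ : Λ → Bool) (hσ : σ ∈ (marginalOn μ Λ).support),
      marginalRatio (pin μ σ hσ) i ≤ ENNReal.ofReal ζ ∧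
      marginalRatio (pin μ σ hσ) i ≤ ENNReal.ofReal ζ *
        marginalRatio
          (pin μ (Finset.restrict₂ (π := fun _ => Bool) hS σ) (restrict₂_mem_marginalOn hS hσ)) i

/-- The unnormalized weight `μ(σ) ∏_{i : σ_i = +1} lam_i`. -/
def fieldWeight [Fintype ι] (lam : ι → ℝ) (μ : PMF (ι → Bool)) (x : ι → Bool) : ℝ≥0∞ :=
  μ x * ∏ i with x i = true, ENNReal.ofReal (lam i)

theorem tsum_fieldWeight_ne_zero [Fintype ι] (lam : ι → ℝ) (hlam : ∀ i, 0 < lam i)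
    (μ : PMF (ι → Bool)) : ∑' x, fieldWeight lam μ x ≠ 0 := by
  obtain ⟨x, hx⟩ := μ.support_nonempty
  intro h
  have h0 : fieldWeight lam μ x = 0 := ENNReal.tsum_eq_zero.1 h x
  rcases mul_eq_zero.1 h0 with h1 | h1
  · exact (PMF.mem_support_iff _ _).1 hx h1
  · obtain ⟨i, -, hi⟩ := Finset.prod_eq_zero_iff.1 h1
    exact absurd (ENNReal.ofReal_eq_zero.1 hi) (not_le.2 (hlam i))

theorem tsum_fieldWeight_ne_top [Fintype ι] (lam : ι → ℝ)
    (μ : PMF (ι → Bool)) : ∑' x, fieldWeight lam μ x ≠ ∞ := by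
  classical
  rw [tsum_fintype]
  refine ENNReal.sum_ne_top.2 fun x _ => ENNReal.mul_ne_top (μ.apply_ne_top x) ?_
  exact ENNReal.prod_ne_top fun i _ => ENNReal.ofReal_ne_top

/-- The distribution `lam * μ`, obtained from `μ` by the positive local fields `lam`. -/
def magnetize [Fintype ι] (lam : ι → ℝ) (hlam : ∀ i, 0 < lam i) (μ : PMF (ι → Bool)) :
    PMF (ι → Bool) :=
  PMF.normalize (fieldWeight lam μ) (tsum_fieldWeight_ne_zero lam hlam μ)
    (tsum_fieldWeight_ne_top lam μ)

/-- Spectral independence for all fields in `(0,1+ε]^ι`, and marginal stability for all fields in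
`(0,1]^ι`. -/
structure StrongCondition [Fintype ι] [DecidableEq ι] (d : Diagonal) (η ε ζ : ℝ)
    (μ : PMF (ι → Bool)) : Prop where
  one_lt_eta : 1 < η
  eps_pos : 0 < ε
  one_lt_zeta : 1 < ζ
  spectrallyIndependent : ∀ (lam : ι → ℝ) (hlam : ∀ i, 0 < lam i), (∀ i, lam i ≤ 1 + ε) →
    SpectrallyIndependent d η (magnetize lam hlam μ)
  marginallyStable : ∀ (lam : ι → ℝ) (hlam : ∀ i, 0 < lam i), (∀ i, lam i ≤ 1) →
    MarginallyStable ζ (magnetize lam hlam μ)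

/-- Spectral independence for all fields in `(0,1+ε]^ι`, and marginal stability of `μ` itself. -/
structure WeakCondition [Fintype ι] [DecidableEq ι] (d : Diagonal) (η ε ζ : ℝ)
    (μ : PMF (ι → Bool)) : Prop where
  one_lt_eta : 1 < η
  eps_pos : 0 < ε
  one_lt_zeta : 1 < ζ
  spectrallyIndependent : ∀ (lam : ι → ℝ) (hlam : ∀ i, 0 < lam i), (∀ i, lam i ≤ 1 + ε) →
    SpectrallyIndependent d η (magnetize lam hlam μ)
  marginallyStable : MarginallyStable ζ μ

/-- The `k`-transformation `μ_k`: draw `X` from `μ` and, independently and uniformly, an index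
`J i` in `[k]` for every `i`; then `Y (i, j)` is `+1` exactly if `X i` is `+1` and `j = J i`. -/
def kTransform [Fintype ι] [DecidableEq ι] (μ : PMF (ι → Bool)) (k : ℕ) (hk : 1 ≤ k) :
    PMF (ι × Fin k → Bool) :=
  haveI : Nonempty (Fin k) := ⟨⟨0, hk⟩⟩
  μ.bind fun X =>
    (PMF.uniformOfFintype (ι → Fin k)).map fun J p => X p.1 && decide (J p.1 = p.2)

end SpinDist

end

open scoped ENNReal

set_option linter.unusedSectionVars false

/-! Pinnings, conditionings and local fields all multiply a distribution by a product of nonnegative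
site weights, so they are treated uniformly as tilts (`IsTilt`). In `kTransform μ k hk` the blocks
are conditionally independent given X, so integrating out the positions of the `+1`s turns site
weights `h` on ι × [k] into site weights `blockWeight h` on ι with the same total mass
(`totalWeight_kTransform`). A pinned and magnetized μ_k thus sits over a tilt M of μ, which is
itself a pinned and magnetized μ (`isTilt_pin_magnetize`). Its fields are averages of fields of μ_k,
hence obey the same upper bound (`blockWeight_true_le`).

Spectral independence: between different blocks the influence of p on q is at most that of p.1 on
q.1 in M, times the conditional probability `slotProb h q`; these probabilities sum to at most 1
over a block. Inside a block each row of influences sums to at most 2. A positive vector v with Ψ_M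
v ≤ θ v, lifted to be constant on blocks, therefore satisfies Ψ w ≤ (θ + 2) w, which bounds the
spectral radius. Such a v exists for every θ above the spectral radius of Ψ_M.

Marginal stability: pinning some sites of a block to `-1` lowers the field of that block in μ, so
the tilts for σ and for its restriction differ in fields as well as in pinnings. They are compared
through pinnings of all sites but one, whose ratio does not depend on the fields elsewhere:
stability bounds each such ratio by ζ times the ratio of the larger tilt, and summing transfers the
bound to the smaller tilt (`tilt_ratio_le`). The slots other than p in its block cost the extra
factor 2. -/

namespace SpinDist

/-! ### Spectral radius of a nonnegative matrix via positive test vectors. -/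

section Spectral

variable {α : Type*} [Fintype α] [DecidableEq α]

theorem spectralRadius_le_of_mulVec_le {B : Matrix α α ℝ} (hB : ∀ i j, 0 ≤ B i j) {w : α → ℝ}
    (hw : ∀ i, 0 < w i) {θ : ℝ} (h : ∀ i, ∑ j, B i j * w j ≤ θ * w i) :
    spectralRadius ℂ (B.map Complex.ofReal) ≤ ENNReal.ofReal θ := by
  refine iSup₂_le fun z hz => ?_
  rw [spectrum.mem_iff, Matrix.isUnit_iff_isUnit_det, isUnit_iff_ne_zero, not_not] at hz
  obtain ⟨x, hx0, hx⟩ := Matrix.exists_mulVec_eq_zero_iff.2 hz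
  have heig : ∀ i, z * x i = ∑ j, (B i j : ℂ) * x j := by
    intro i
    have := congrFun hx i
    rw [Matrix.sub_mulVec, Matrix.algebraMap_eq_diagonal] at this
    simp only [Pi.sub_apply, Matrix.mulVec_diagonal, Pi.zero_apply, sub_eq_zero,
      Pi.algebraMap_apply, Algebra.algebraMap_self, RingHom.id_apply] at this
    rw [this]
    rfl
  obtain ⟨i₀, hi₀⟩ : ∃ i, x i ≠ 0 := by
    by_contra! hc
    exact hx0 (funext hc)
  -- The eigenvalue equation is read at the coordinate where the eigenvector is largest relative to
  -- `w`.
  obtain ⟨p, -, hp⟩ := Finset.exists_max_image Finset.univ (fun i => ‖x i‖ / w i)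
    ⟨i₀, Finset.mem_univ _⟩
  set c := ‖x p‖ / w p with hc
  have hle : ∀ q, ‖x q‖ ≤ c * w q := fun q =>
    (div_le_iff₀ (hw q)).1 (hp q (Finset.mem_univ _))
  have hcpos : 0 < c :=
    lt_of_lt_of_le (div_pos (norm_pos_iff.2 hi₀) (hw i₀)) (hp i₀ (Finset.mem_univ _))
  have hxp : ‖x p‖ = c * w p := by rw [hc, div_mul_cancel₀ _ (hw p).ne']
  have key : ‖z‖ * (c * w p) ≤ θ * (c * w p) := by
    calc ‖z‖ * (c * w p) = ‖∑ j, (B p j : ℂ) * x j‖ := by rw [← heig, norm_mul, hxp]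
      _ ≤ ∑ j, B p j * (c * w j) := by
        refine (norm_sum_le _ _).trans (Finset.sum_le_sum fun j _ => ?_)
        rw [norm_mul, Complex.norm_real, Real.norm_of_nonneg (hB p j)]
        exact mul_le_mul_of_nonneg_left (hle j) (hB p j)
      _ = c * ∑ j, B p j * w j := by
        rw [Finset.mul_sum]; exact Finset.sum_congr rfl fun j _ => by ring
      _ ≤ c * (θ * w p) := mul_le_mul_of_nonneg_left (h p) hcpos.le
      _ = θ * (c * w p) := by ring
  have hz : ‖z‖ ≤ θ := le_of_mul_le_mul_right key (mul_pos hcpos (hw p))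
  change ‖z‖ₑ ≤ _
  rw [← ofReal_norm]
  exact ENNReal.ofReal_le_ofReal hz

attribute [local instance] Matrix.linftyOpNormedRing Matrix.linftyOpNormedAlgebra in
-- Gelfand's formula in the ℓ∞ operator norm, which is the maximal absolute row sum.
theorem exists_pow_row_sum_le {A : Matrix α α ℝ}
    {η θ : ℝ} (hη : 0 ≤ η) (hθ : η < θ)
    (h : spectralRadius ℂ (A.map Complex.ofReal) ≤ ENNReal.ofReal η) :
    ∃ N : ℕ, 1 ≤ N ∧ ∀ i, ∑ j, (A ^ N) i j ≤ θ ^ N := by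
  have hlim := spectrum.pow_nnnorm_pow_one_div_tendsto_nhds_spectralRadius
    (A.map Complex.ofReal)
  have hlt : spectralRadius ℂ (A.map Complex.ofReal) < ENNReal.ofReal θ :=
    h.trans_lt ((ENNReal.ofReal_lt_ofReal_iff (hη.trans_lt hθ)).2 hθ)
  obtain ⟨N, hN, hN1⟩ :=
    ((hlim.eventually_lt_const hlt).and (Filter.eventually_ge_atTop 1)).exists
  refine ⟨N, hN1, fun i => ?_⟩
  have hN0 : (N : ℝ) ≠ 0 := by positivity
  have hnorm : ‖(A.map Complex.ofReal) ^ N‖ ≤ θ ^ N := by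
    have h1 := ENNReal.rpow_le_rpow hN.le (Nat.cast_nonneg N : (0 : ℝ) ≤ N)
    rw [← ENNReal.rpow_mul, one_div, inv_mul_cancel₀ hN0, ENNReal.rpow_one,
      ENNReal.rpow_natCast, ← ENNReal.ofReal_pow (hη.trans hθ.le)] at h1
    have h2 := ENNReal.toReal_mono ENNReal.ofReal_ne_top h1
    rwa [ENNReal.toReal_ofReal (pow_nonneg (hη.trans hθ.le) _)] at h2
  have hmap : (A.map Complex.ofReal) ^ N = (A ^ N).map Complex.ofReal := by
    have := (map_pow (Complex.ofRealHom.mapMatrix (m := α)) A N).symm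
    exact this
  rw [hmap] at hnorm
  refine le_trans ?_ hnorm
  rw [Matrix.linfty_opNorm_def]
  have h3 : (∑ j, ‖((A ^ N).map Complex.ofReal) i j‖₊) ≤
      (Finset.univ : Finset α).sup fun i => ∑ j, ‖((A ^ N).map Complex.ofReal) i j‖₊ :=
    Finset.le_sup (f := fun i => ∑ j, ‖((A ^ N).map Complex.ofReal) i j‖₊) (Finset.mem_univ i)
  refine le_trans ?_ (NNReal.coe_le_coe.2 h3)
  push_cast
  refine Finset.sum_le_sum fun j _ => ?_
  rw [Matrix.map_apply, Complex.norm_real]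
  exact le_abs_self _

/-- The vector is the truncated Neumann series v = ∑_{m<N} θ⁻ᵐ Aᵐ 1. Applying A/θ shifts the sum by
one, and the new term θ⁻ᴺ Aᴺ 1 is at most the lost term 1 by the choice of N. Truncation gives
positivity without assuming A irreducible. -/
theorem exists_pos_mulVec_le {A : Matrix α α ℝ} (hA : ∀ i j, 0 ≤ A i j)
    {η θ : ℝ} (hη : 0 ≤ η) (hθ : η < θ)
    (h : spectralRadius ℂ (A.map Complex.ofReal) ≤ ENNReal.ofReal η) :
    ∃ v : α → ℝ, (∀ i, 0 < v i) ∧ ∀ i, ∑ j, A i j * v j ≤ θ * v i := by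
  obtain ⟨N, hN1, hN⟩ := exists_pow_row_sum_le hη hθ h
  have hθ0 : 0 < θ := hη.trans_lt hθ
  have hpow : ∀ m i j, 0 ≤ (A ^ m) i j := by
    intro m
    induction m with
    | zero => intro i j; rw [pow_zero, Matrix.one_apply]; split_ifs <;> norm_num
    | succ m ih =>
      intro i j
      rw [pow_succ, Matrix.mul_apply]
      exact Finset.sum_nonneg fun l _ => mul_nonneg (ih i l) (hA l j)
  set f : α → ℕ → ℝ := fun i m => (θ ^ m)⁻¹ * ∑ j, (A ^ m) i j with hf
  have hf0 : ∀ i, f i 0 = 1 := fun i => by simp [hf, Matrix.one_apply]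
  have hfnn : ∀ i m, 0 ≤ f i m := fun i m =>
    mul_nonneg (inv_nonneg.2 (pow_nonneg hθ0.le m)) (Finset.sum_nonneg fun j _ => hpow m i j)
  have hstep : ∀ i m, ∑ j, A i j * f j m = θ * f i (m + 1) := by
    intro i m
    have : ∑ j, (A ^ (m + 1)) i j = ∑ l, A i l * ∑ j, (A ^ m) l j := by
      simp_rw [pow_succ', Matrix.mul_apply, Finset.mul_sum]
      exact Finset.sum_comm
    simp only [hf]
    rw [this, pow_succ, mul_inv, ← mul_assoc, mul_comm θ, mul_assoc _ θ⁻¹,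
      inv_mul_cancel₀ hθ0.ne', mul_one, Finset.mul_sum]
    exact Finset.sum_congr rfl fun j _ => by ring
  refine ⟨fun i => ∑ m ∈ Finset.range N, f i m, fun i => ?_, fun i => ?_⟩
  · refine lt_of_lt_of_le zero_lt_one ((hf0 i).ge.trans ?_)
    exact Finset.single_le_sum (fun m _ => hfnn i m) (Finset.mem_range.2 hN1)
  · simp_rw [Finset.mul_sum]
    rw [Finset.sum_comm]
    simp_rw [hstep]
    rw [← Finset.mul_sum, ← Finset.mul_sum]
    refine mul_le_mul_of_nonneg_left ?_ hθ0.le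
    have h1 := Finset.sum_range_succ (f i) N
    have h2 := Finset.sum_range_succ' (f i) N
    have h3 : f i N ≤ 1 := (inv_mul_le_one₀ (pow_pos hθ0 N)).2 (hN i)
    have h4 := hf0 i
    linarith

end Spectral

end SpinDist

noncomputable section

namespace SpinDist

/-! ### Product site weights and tilted distributions. -/

section Weights

variable {ι : Type*}

/-- The site weight that forces the spin at `i` to be `b`. -/
def spinWeight [DecidableEq ι] (i : ι) (b : Bool) : ι → Bool → ℝ :=
  fun i' b' => if i' = i ∧ b' ≠ b then 0 else 1

/-- The site weight of a pinning. -/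
def pinWeight [DecidableEq ι] {Λ : Finset ι} (σ : Λ → Bool) : ι → Bool → ℝ :=
  fun i b => if h : i ∈ Λ then (if σ ⟨i, h⟩ = b then 1 else 0) else 1

/-- The site weight of local fields. -/
def siteField (lam : ι → ℝ) : ι → Bool → ℝ := fun i b => if b then lam i else 1

variable [Fintype ι] [DecidableEq ι]

/-- The total weight `∑ x, μ x ∏ i, g i (x i)`. -/
def totalWeight (μ : PMF (ι → Bool)) (g : ι → Bool → ℝ) : ℝ :=
  ∑ x, (μ x).toReal * ∏ i, g i (x i)

/-- `M` is proportional to `μ` reweighted by the product of the site weights `g`. -/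
def IsTilt (μ : PMF (ι → Bool)) (g : ι → Bool → ℝ) (M : PMF (ι → Bool)) : Prop :=
  ∃ c : ℝ, 0 < c ∧ ∀ x, (M x).toReal = c * ((μ x).toReal * ∏ i, g i (x i))

variable {μ M N : PMF (ι → Bool)} {g h : ι → Bool → ℝ}

theorem totalWeight_nonneg (hg : ∀ i b, 0 ≤ g i b) : 0 ≤ totalWeight μ g :=
  Finset.sum_nonneg fun x _ => mul_nonneg ENNReal.toReal_nonneg
    (Finset.prod_nonneg fun i _ => hg i (x i))

theorem totalWeight_one : totalWeight μ 1 = 1 := by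
  have h := μ.tsum_coe
  rw [tsum_fintype] at h
  simp only [totalWeight, Pi.one_apply, Finset.prod_const_one, mul_one]
  rw [← ENNReal.toReal_sum fun x _ => μ.apply_ne_top x, h, ENNReal.toReal_one]

theorem totalWeight_mono (hg : ∀ i b, 0 ≤ g i b) (hgh : ∀ i b, g i b ≤ h i b) :
    totalWeight μ g ≤ totalWeight μ h :=
  Finset.sum_le_sum fun x _ => mul_le_mul_of_nonneg_left
    (Finset.prod_le_prod (fun i _ => hg i (x i)) fun i _ => hgh i (x i)) ENNReal.toReal_nonneg

theorem prod_spinWeight (i : ι) (b : Bool) (x : ι → Bool) :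
    ∏ i', spinWeight i b i' (x i') = if x i = b then 1 else 0 := by
  rw [Finset.prod_eq_single i]
  · by_cases hb : x i = b <;> simp [spinWeight, hb]
  · intro j _ hj
    simp [spinWeight, hj]
  · simp

theorem prod_pinWeight {Λ : Finset ι} (σ : Λ → Bool) (x : ι → Bool) :
    ∏ i, pinWeight σ i (x i) = if Λ.restrict x = σ then 1 else 0 := by
  split_ifs with hx
  · refine Finset.prod_eq_one fun i _ => ?_
    unfold pinWeight
    split_ifs with h1 h2
    · rfl
    · exact absurd (congrFun hx ⟨i, h1⟩).symm h2
    · rfl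
  · obtain ⟨i, hi⟩ : ∃ i, Λ.restrict x i ≠ σ i := by
      by_contra! hc
      exact hx (funext hc)
    refine Finset.prod_eq_zero (Finset.mem_univ i.1) ?_
    unfold pinWeight
    rw [dif_pos i.2, if_neg]
    exact fun hc => hi hc.symm

theorem spinWeight_nonneg (i : ι) (b : Bool) (i' : ι) (b' : Bool) : 0 ≤ spinWeight i b i' b' := by
  unfold spinWeight; split_ifs <;> norm_num

theorem pinWeight_nonneg {Λ : Finset ι} (σ : Λ → Bool) (i : ι) (b : Bool) :
    0 ≤ pinWeight σ i b := by
  unfold pinWeight; split_ifs <;> norm_num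

theorem pinWeight_le_one {Λ : Finset ι} (σ : Λ → Bool) (i : ι) (b : Bool) :
    pinWeight σ i b ≤ 1 := by
  unfold pinWeight; split_ifs <;> norm_num

theorem prod_siteField (lam : ι → ℝ) (x : ι → Bool) :
    ∏ i, siteField lam i (x i) = ∏ i with x i = true, lam i := by
  rw [Finset.prod_filter]
  rfl

theorem totalWeight_mul_spinWeight (i : ι) (b : Bool) :
    totalWeight μ (g * spinWeight i b) =
      ∑ x, if x i = b then (μ x).toReal * ∏ i', g i' (x i') else 0 := by
  refine Finset.sum_congr rfl fun x _ => ?_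
  simp only [Pi.mul_apply, Finset.prod_mul_distrib, prod_spinWeight]
  split_ifs <;> simp

theorem totalWeight_spin_add (i : ι) :
    totalWeight μ (g * spinWeight i true) + totalWeight μ (g * spinWeight i false) =
      totalWeight μ g := by
  rw [totalWeight_mul_spinWeight, totalWeight_mul_spinWeight, ← Finset.sum_add_distrib]
  refine Finset.sum_congr rfl fun x _ => ?_
  cases x i <;> simp

/-- The normalizing constant is eliminated by testing against the weight 1; probabilities under a
tilt become ratios of total weights of μ. -/
theorem IsTilt.totalWeight_eq (hM : IsTilt μ g M) (f : ι → Bool → ℝ) :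
    totalWeight M f * totalWeight μ g = totalWeight μ (g * f) := by
  obtain ⟨c, hc, hx⟩ := hM
  have key : ∀ f : ι → Bool → ℝ, totalWeight M f = c * totalWeight μ (g * f) := by
    intro f
    unfold totalWeight
    rw [Finset.mul_sum]
    refine Finset.sum_congr rfl fun x _ => ?_
    rw [hx]
    simp only [Pi.mul_apply, Finset.prod_mul_distrib]
    ring
  have h1 := key 1
  rw [totalWeight_one, mul_one] at h1
  rw [key f, mul_right_comm, ← h1, one_mul]

theorem IsTilt.totalWeight_ne_zero (hM : IsTilt μ g M) : totalWeight μ g ≠ 0 := by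
  obtain ⟨c, hc, hx⟩ := hM
  have : totalWeight M 1 = c * totalWeight μ g := by
    unfold totalWeight
    rw [Finset.mul_sum]
    refine Finset.sum_congr rfl fun x _ => ?_
    rw [hx]
    simp
  rw [totalWeight_one] at this
  intro h0
  rw [h0, mul_zero] at this
  exact one_ne_zero this

theorem IsTilt.trans (h1 : IsTilt μ g M) (h2 : IsTilt M h N) : IsTilt μ (g * h) N := by
  obtain ⟨c, hc, hx⟩ := h1
  obtain ⟨c', hc', hx'⟩ := h2
  refine ⟨c' * c, mul_pos hc' hc, fun x => ?_⟩
  rw [hx', hx]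
  simp only [Pi.mul_apply, Finset.prod_mul_distrib]
  ring

theorem isTilt_filter (s : Set (ι → Bool)) (hs : ∃ x ∈ s, x ∈ μ.support)
    (hg : ∀ x, ∏ i, g i (x i) = s.indicator 1 x) : IsTilt μ g (μ.filter s hs) := by
  have hfin : ∑' x, s.indicator μ x ≠ ∞ := by
    refine ne_top_of_le_ne_top ENNReal.one_ne_top ?_
    rw [← μ.tsum_coe]
    exact ENNReal.tsum_le_tsum fun x => Set.indicator_le_self _ _ _
  have hpos : ∑' x, s.indicator μ x ≠ 0 := by
    obtain ⟨x, hx, hxμ⟩ := hs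
    intro h0
    have := ENNReal.tsum_eq_zero.1 h0 x
    rw [Set.indicator_of_mem hx] at this
    exact (PMF.mem_support_iff _ _).1 hxμ this
  refine ⟨(∑' x, s.indicator μ x).toReal⁻¹, inv_pos.2 (ENNReal.toReal_pos hpos hfin),
    fun x => ?_⟩
  rw [PMF.filter_apply, ENNReal.toReal_mul, ENNReal.toReal_inv, mul_comm, hg]
  by_cases hx : x ∈ s <;> simp [hx]

theorem isTilt_pinAt (i : ι) (b : Bool) (hb : b ∈ (marginal μ i).support) :
    IsTilt μ (spinWeight i b) (pinAt μ i b hb) :=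
  isTilt_filter _ _ fun x => by
    rw [prod_spinWeight]; by_cases hx : x i = b <;> simp [hx]

theorem isTilt_pin {Λ : Finset ι} (σ : Λ → Bool) (hσ : σ ∈ (marginalOn μ Λ).support) :
    IsTilt μ (pinWeight σ) (pin μ σ hσ) :=
  isTilt_filter _ _ fun x => by
    rw [prod_pinWeight]; by_cases hx : Λ.restrict x = σ <;> simp [hx]

theorem isTilt_magnetize (lam : ι → ℝ) (hlam : ∀ i, 0 < lam i) :
    IsTilt μ (siteField lam) (magnetize lam hlam μ) := by
  refine ⟨(∑' x, fieldWeight lam μ x).toReal⁻¹, inv_pos.2 (ENNReal.toReal_pos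
    (tsum_fieldWeight_ne_zero lam hlam μ) (tsum_fieldWeight_ne_top lam μ)), fun x => ?_⟩
  rw [magnetize, PMF.normalize_apply, ENNReal.toReal_mul, ENNReal.toReal_inv, mul_comm,
    fieldWeight, ENNReal.toReal_mul, ENNReal.toReal_prod, prod_siteField]
  congr 2
  exact Finset.prod_congr rfl fun i _ => ENNReal.toReal_ofReal (hlam i).le

theorem toReal_marginal (i : ι) (b : Bool) :
    (marginal μ i b).toReal = totalWeight μ (spinWeight i b) := by
  have : totalWeight μ (spinWeight i b) = totalWeight μ (1 * spinWeight i b) := by rw [one_mul]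
  rw [this, totalWeight_mul_spinWeight, marginal, PMF.map_apply, tsum_fintype,
    ENNReal.toReal_sum]
  · refine Finset.sum_congr rfl fun x _ => ?_
    by_cases hx : x i = b
    · simp [hx]
    · simp [hx, Ne.symm hx]
  · intro x _
    split_ifs
    · exact μ.apply_ne_top x
    · exact ENNReal.zero_ne_top

theorem mem_support_marginal_iff (i : ι) (b : Bool) :
    b ∈ (marginal μ i).support ↔ totalWeight μ (spinWeight i b) ≠ 0 := by
  rw [← toReal_marginal, PMF.mem_support_iff, ne_eq, ne_eq, ENNReal.toReal_eq_zero_iff]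
  simp [PMF.apply_ne_top]

/-! ### Influences in terms of one- and two-site probabilities. -/

theorem tvDist_bool (p q : PMF Bool) :
    tvDist p q = |(p true).toReal - (q true).toReal| := by
  have key : ∀ p : PMF Bool, (p false).toReal = 1 - (p true).toReal := by
    intro p
    have h := p.tsum_coe
    rw [tsum_fintype, Fintype.sum_bool] at h
    have h2 := congrArg ENNReal.toReal h
    rw [ENNReal.toReal_add (p.apply_ne_top _) (p.apply_ne_top _), ENNReal.toReal_one] at h2
    linarith
  rw [tvDist, Fintype.sum_bool, key p, key q, abs_sub_comm (1 - _)]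
  have : 1 - (q true).toReal - (1 - (p true).toReal) = (p true).toReal - (q true).toReal := by
    ring
  rw [this]
  ring

/-- The probability that the spin at `i` is `+1`. -/
def plusProb (μ : PMF (ι → Bool)) (i : ι) : ℝ := totalWeight μ (spinWeight i true)

/-- The probability that the spins at `i` and `j` are both `+1`. -/
def plusProb₂ (μ : PMF (ι → Bool)) (i j : ι) : ℝ :=
  totalWeight μ (spinWeight i true * spinWeight j true)

theorem totalWeight_spin_false (i : ι) :
    totalWeight μ (spinWeight i false) = 1 - plusProb μ i := by
  have := totalWeight_spin_add (μ := μ) (g := 1) i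
  rw [one_mul, one_mul, totalWeight_one] at this
  rw [plusProb]
  linarith

theorem plusProb_nonneg (i : ι) : 0 ≤ plusProb μ i := totalWeight_nonneg (spinWeight_nonneg _ _)

theorem plusProb_le_one (i : ι) : plusProb μ i ≤ 1 := by
  have := totalWeight_spin_false (μ := μ) i
  have h2 : 0 ≤ totalWeight μ (spinWeight i false) := totalWeight_nonneg (spinWeight_nonneg _ _)
  linarith

theorem plusProb₂_nonneg (i j : ι) : 0 ≤ plusProb₂ μ i j :=
  totalWeight_nonneg fun _ _ => mul_nonneg (spinWeight_nonneg _ _ _ _) (spinWeight_nonneg _ _ _ _)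

theorem plusProb₂_comm (i j : ι) : plusProb₂ μ i j = plusProb₂ μ j i := by
  rw [plusProb₂, plusProb₂, mul_comm]

theorem totalWeight_spin_false_true (i j : ι) :
    totalWeight μ (spinWeight i false * spinWeight j true) = plusProb μ j - plusProb₂ μ i j := by
  have := totalWeight_spin_add (μ := μ) (g := spinWeight j true) i
  rw [plusProb, plusProb₂, mul_comm, mul_comm (spinWeight i true)]
  linarith

theorem plusProb₂_le (i j : ι) : plusProb₂ μ i j ≤ plusProb μ j := by
  have := totalWeight_spin_false_true (μ := μ) i j
  have h2 : 0 ≤ totalWeight μ (spinWeight i false * spinWeight j true) :=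
    totalWeight_nonneg fun _ _ =>
      mul_nonneg (spinWeight_nonneg _ _ _ _) (spinWeight_nonneg _ _ _ _)
  linarith

theorem toReal_marginal_pinAt (i j : ι) (b c : Bool) (hb : b ∈ (marginal μ i).support) :
    (marginal (pinAt μ i b hb) j c).toReal =
      totalWeight μ (spinWeight i b * spinWeight j c) / totalWeight μ (spinWeight i b) := by
  rw [toReal_marginal, eq_div_iff ((mem_support_marginal_iff i b).1 hb)]
  exact (isTilt_pinAt i b hb).totalWeight_eq _

theorem tvDist_pinAt (i j : ι) (ht : true ∈ (marginal μ i).support)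
    (hf : false ∈ (marginal μ i).support) :
    tvDist (marginal (pinAt μ i true ht) j) (marginal (pinAt μ i false hf) j) =
      |plusProb₂ μ i j / plusProb μ i -
        (plusProb μ j - plusProb₂ μ i j) / (1 - plusProb μ i)| := by
  rw [tvDist_bool, toReal_marginal_pinAt, toReal_marginal_pinAt, totalWeight_spin_false,
    totalWeight_spin_false_true]
  rfl

theorem tvDist_nonneg {α : Type*} [Fintype α] (p q : PMF α) : 0 ≤ tvDist p q :=
  mul_nonneg (by norm_num) (Finset.sum_nonneg fun _ _ => abs_nonneg _)

theorem tvDist_comm {α : Type*} [Fintype α] (p q : PMF α) : tvDist p q = tvDist q p := by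
  unfold tvDist
  congr 1
  exact Finset.sum_congr rfl fun _ _ => abs_sub_comm _ _

theorem tvDist_self {α : Type*} [Fintype α] (p : PMF α) : tvDist p p = 0 := by
  simp [tvDist]

theorem maxInfluence_nonneg (i j : ι) : 0 ≤ maxInfluence μ i j :=
  Real.iSup_nonneg fun _ => Real.iSup_nonneg fun _ => tvDist_nonneg _ _

/-- If the spin at `i` is deterministic, its support is a single point and the influence vanishes,
so only the nondegenerate case needs a bound. -/
theorem maxInfluence_le {i j : ι} {C : ℝ} (hC : 0 ≤ C)
    (h : 0 < plusProb μ i → plusProb μ i < 1 → |plusProb₂ μ i j / plusProb μ i -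
        (plusProb μ j - plusProb₂ μ i j) / (1 - plusProb μ i)| ≤ C) :
    maxInfluence μ i j ≤ C := by
  have key : ∀ (ht : true ∈ (marginal μ i).support) (hf : false ∈ (marginal μ i).support),
      tvDist (marginal (pinAt μ i true ht) j) (marginal (pinAt μ i false hf) j) ≤ C := by
    intro ht hf
    rw [tvDist_pinAt]
    have h1 := (mem_support_marginal_iff i true).1 ht
    have h2 := (mem_support_marginal_iff i false).1 hf
    rw [totalWeight_spin_false] at h2
    refine h (lt_of_le_of_ne (plusProb_nonneg i) (Ne.symm h1))
      (lt_of_le_of_ne (plusProb_le_one i) fun h3 => h2 (by rw [h3, sub_self]))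
  refine Real.iSup_le (fun x => Real.iSup_le (fun y => ?_) hC) hC
  obtain ⟨x, hx⟩ := x
  obtain ⟨y, hy⟩ := y
  cases x <;> cases y
  · rw [tvDist_self]; exact hC
  · rw [tvDist_comm]; exact key hy hx
  · exact key hx hy
  · rw [tvDist_self]; exact hC

theorem le_maxInfluence {i j : ι} (h0 : 0 < plusProb μ i) (h1 : plusProb μ i < 1) :
    |plusProb₂ μ i j / plusProb μ i -
        (plusProb μ j - plusProb₂ μ i j) / (1 - plusProb μ i)| ≤ maxInfluence μ i j := by
  have ht : true ∈ (marginal μ i).support := (mem_support_marginal_iff i true).2 h0.ne'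
  have hf : false ∈ (marginal μ i).support := (mem_support_marginal_iff i false).2 (by
    rw [totalWeight_spin_false]; linarith)
  rw [← tvDist_pinAt i j ht hf]
  unfold maxInfluence
  refine le_trans ?_ (le_ciSup (Set.finite_range _).bddAbove ⟨true, ht⟩)
  exact le_ciSup (f := fun y : (marginal μ i).support =>
    tvDist (marginal (pinAt μ i true ht) j) (marginal (pinAt μ i y.1 y.2) j))
    (Set.finite_range _).bddAbove ⟨false, hf⟩

theorem influence_nonneg (d : Diagonal) (i j : ι) : 0 ≤ influence d μ i j := by
  cases d
  · exact maxInfluence_nonneg i j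
  · change 0 ≤ if i = j then (0 : ℝ) else maxInfluence μ i j
    split_ifs
    · exact le_rfl
    · exact maxInfluence_nonneg i j

theorem influence_le (d : Diagonal) (i j : ι) : influence d μ i j ≤ maxInfluence μ i j := by
  cases d
  · exact le_rfl
  · change (if i = j then (0 : ℝ) else maxInfluence μ i j) ≤ _
    split_ifs
    · exact maxInfluence_nonneg i j
    · exact le_rfl

theorem influence_of_ne (d : Diagonal) {i j : ι} (hij : i ≠ j) :
    influence d μ i j = maxInfluence μ i j := by
  cases d
  · rfl
  · exact if_neg hij

/-! ### Realizing a tilt as a pinning of a magnetized distribution. -/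

theorem isTilt_pin_magnetize_of_field (hg0 : ∀ i b, 0 ≤ g i b) (Λ : Finset ι) (lam : ι → ℝ)
    (hlam : ∀ i, 0 < lam i) (hfield : ∀ i, i ∉ Λ → g i true = lam i * g i false)
    (x : ι → Bool) (hx : ∀ i, 0 < g i (x i)) (hpin : ∀ i ∈ Λ, g i (!x i) = 0)
    (hσ : Λ.restrict x ∈ (marginalOn (magnetize lam hlam μ) Λ).support) :
    IsTilt μ g (pin (magnetize lam hlam μ) (Λ.restrict x) hσ) := by
  obtain ⟨c, hc, hc'⟩ := (isTilt_magnetize (μ := μ) lam hlam).trans (isTilt_pin _ hσ)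
  -- Site by site the two weights agree up to a positive scalar, which the normalization absorbs.
  have hs : ∀ i, ∃ s : ℝ, 0 < s ∧
      ∀ b, (siteField lam * pinWeight (Λ.restrict x)) i b = s * g i b := by
    intro i
    by_cases hi : i ∈ Λ
    · have hL : 0 < siteField lam i (x i) := by
        unfold siteField; split_ifs
        · exact hlam i
        · exact one_pos
      refine ⟨siteField lam i (x i) / g i (x i), div_pos hL (hx i), fun b => ?_⟩
      by_cases hb : b = x i
      · subst hb
        rw [div_mul_cancel₀ _ (hx i).ne']
        simp [pinWeight, hi]
      · have hb' : b = !x i := by cases b <;> cases h : x i <;> simp_all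
        rw [hb', hpin i hi]
        simp [pinWeight, hi]
    · have hfalse : 0 < g i false := by
        refine lt_of_le_of_ne (hg0 i false) fun h0 => ?_
        have h1 := hx i
        cases h : x i
        · rw [h, ← h0] at h1; exact lt_irrefl _ h1
        · rw [h, hfield i hi, ← h0, mul_zero] at h1; exact lt_irrefl _ h1
      refine ⟨(g i false)⁻¹, inv_pos.2 hfalse, fun b => ?_⟩
      cases b
      · simp [pinWeight, hi, siteField, hfalse.ne']
      · simp only [Pi.mul_apply, pinWeight, hi, siteField, hfield i hi]
        field_simp
        simp
  choose s hs0 hs using hs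
  refine ⟨c * ∏ i, s i, mul_pos hc (Finset.prod_pos fun i _ => hs0 i), fun y => ?_⟩
  rw [hc']
  simp only [hs, Finset.prod_mul_distrib]
  ring

theorem restrict_mem_support_marginalOn (Λ : Finset ι) (x : ι → Bool) (hx : μ x ≠ 0) :
    Λ.restrict x ∈ (marginalOn μ Λ).support :=
  (PMF.mem_support_map_iff _ _ _).2 ⟨x, (PMF.mem_support_iff _ _).2 hx, rfl⟩

theorem IsTilt.ne_zero (hM : IsTilt μ g M) {x : ι → Bool} (hx : μ x ≠ 0)
    (hg : ∀ i, g i (x i) ≠ 0) : M x ≠ 0 := by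
  obtain ⟨c, hc, h⟩ := hM
  intro h0
  have := h x
  rw [h0, ENNReal.toReal_zero] at this
  refine mul_ne_zero hc.ne' (mul_ne_zero ?_ (Finset.prod_ne_zero_iff.2 fun i _ => hg i)) this.symm
  exact ENNReal.toReal_ne_zero.2 ⟨hx, μ.apply_ne_top x⟩

theorem siteField_pos {lam : ι → ℝ} (hlam : ∀ i, 0 < lam i) (i : ι) (b : Bool) :
    0 < siteField lam i b := by
  unfold siteField; split_ifs
  · exact hlam i
  · exact one_pos

theorem magnetize_ne_zero (lam : ι → ℝ) (hlam : ∀ i, 0 < lam i) {x : ι → Bool} (hx : μ x ≠ 0) :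
    magnetize lam hlam μ x ≠ 0 :=
  (isTilt_magnetize lam hlam).ne_zero hx fun i => (siteField_pos hlam i _).ne'

/-- The sites whose spin is determined by the site weights `g`. -/
def frozenSites (g : ι → Bool → ℝ) : Finset ι :=
  Finset.univ.filter fun i => g i true = 0 ∨ g i false = 0

/-- The fields on the sites that are not frozen by `g`. -/
def fieldOf (g : ι → Bool → ℝ) (i : ι) : ℝ :=
  if g i true = 0 ∨ g i false = 0 then 1 else g i true / g i false

theorem fieldOf_pos (hg0 : ∀ i b, 0 ≤ g i b) (i : ι) : 0 < fieldOf g i := by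
  unfold fieldOf
  split_ifs with h
  · exact one_pos
  · push Not at h
    exact div_pos (lt_of_le_of_ne (hg0 _ _) h.1.symm) (lt_of_le_of_ne (hg0 _ _) h.2.symm)

theorem fieldOf_le (hg0 : ∀ i b, 0 ≤ g i b) {B : ℝ} (hB : 1 ≤ B)
    (hg : ∀ i, g i true ≤ B * g i false ∨ g i false = 0) (i : ι) : fieldOf g i ≤ B := by
  unfold fieldOf
  split_ifs with h
  · exact hB
  · push Not at h
    rw [div_le_iff₀ (lt_of_le_of_ne (hg0 _ _) h.2.symm)]
    exact (hg i).resolve_right h.2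

/-- The configuration `x` has positive tilted weight, so on the frozen sites it takes the only spin
that `g` permits; it serves as the pinning. -/
theorem isTilt_pin_magnetize (hg0 : ∀ i b, 0 ≤ g i b) (x : ι → Bool) (hμ : μ x ≠ 0)
    (hx : ∀ i, g i (x i) ≠ 0) :
    IsTilt μ g (pin (magnetize (fieldOf g) (fieldOf_pos hg0) μ) ((frozenSites g).restrict x)
      (restrict_mem_support_marginalOn _ x (magnetize_ne_zero _ _ hμ))) := by
  refine isTilt_pin_magnetize_of_field hg0 _ _ _ (fun i hi => ?_) x
    (fun i => lt_of_le_of_ne (hg0 _ _) (hx i).symm) (fun i hi => ?_) _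
  · simp only [frozenSites, Finset.mem_filter, Finset.mem_univ, true_and] at hi
    rw [fieldOf, if_neg hi]
    push Not at hi
    rw [div_mul_cancel₀ _ hi.2]
  · simp only [frozenSites, Finset.mem_filter, Finset.mem_univ, true_and] at hi
    have := hx i
    cases h : x i <;> simp_all

end Weights

end SpinDist

end

noncomputable section

namespace SpinDist

/-! ### Reduction of weights on ι × [k] to weights on ι. -/

section KTransform

variable {ι : Type*} [Fintype ι] [DecidableEq ι] {k : ℕ}

/-- The weight of the block of `i` when its `j`-th spin is `+1` and the others are `-1`. -/
def slotWeight (h : ι × Fin k → Bool → ℝ) (i : ι) (j : Fin k) : ℝ :=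
  ∏ l, h (i, l) (decide (j = l))

/-- The site weights on `ι` induced by site weights on `ι × [k]`. -/
def blockWeight (h : ι × Fin k → Bool → ℝ) : ι → Bool → ℝ := fun i b =>
  if b then (k : ℝ)⁻¹ * ∑ j, slotWeight h i j else ∏ l, h (i, l) false

theorem blockWeight_false (h : ι × Fin k → Bool → ℝ) (i : ι) :
    blockWeight h i false = ∏ l, h (i, l) false := rfl

theorem sum_kTransform (μ : PMF (ι → Bool)) (hk : 1 ≤ k) (F : (ι × Fin k → Bool) → ℝ) :
    ∑ y, (kTransform μ k hk y).toReal * F y =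
      ∑ x, (μ x).toReal * ∑ J : ι → Fin k, ((k : ℝ)⁻¹ ^ Fintype.card ι) *
        F (fun p => x p.1 && decide (J p.1 = p.2)) := by
  have : Nonempty (Fin k) := ⟨⟨0, hk⟩⟩
  have key : ∀ y, (kTransform μ k hk y).toReal = ∑ x, (μ x).toReal * ∑ J : ι → Fin k,
      if y = (fun p => x p.1 && decide (J p.1 = p.2)) then (k : ℝ)⁻¹ ^ Fintype.card ι
        else 0 := by
    intro y
    unfold kTransform
    rw [PMF.bind_apply, tsum_fintype, ENNReal.toReal_sum]
    · refine Finset.sum_congr rfl fun x _ => ?_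
      rw [ENNReal.toReal_mul, PMF.map_apply, tsum_fintype, ENNReal.toReal_sum]
      · congr 1
        refine Finset.sum_congr rfl fun J _ => ?_
        split_ifs
        · simp [PMF.uniformOfFintype_apply]
        · rfl
      · intro J _
        split_ifs
        · exact PMF.apply_ne_top _ _
        · exact ENNReal.zero_ne_top
    · intro x _
      exact ENNReal.mul_ne_top (PMF.apply_ne_top _ _) (PMF.apply_ne_top _ _)
  simp_rw [key, Finset.sum_mul]
  rw [Finset.sum_comm]
  refine Finset.sum_congr rfl fun x _ => ?_
  simp_rw [mul_assoc]
  rw [← Finset.mul_sum]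
  simp_rw [Finset.sum_mul]
  rw [Finset.sum_comm]
  congr 1
  refine Finset.sum_congr rfl fun J _ => ?_
  simp

/-- Given X, the weight factorizes over blocks, and the sum over position functions J is an expanded
product of sums over single positions. -/
theorem totalWeight_kTransform (μ : PMF (ι → Bool)) (hk : 1 ≤ k) (h : ι × Fin k → Bool → ℝ) :
    totalWeight (kTransform μ k hk) h = totalWeight μ (blockWeight h) := by
  have hk0 : (k : ℝ) ≠ 0 := by positivity
  unfold totalWeight
  rw [sum_kTransform]
  refine Finset.sum_congr rfl fun x _ => ?_
  congr 1
  -- A block with spin `-1` is also written as an average over positions, of a constant, so that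
  -- both spins expand in the same way.
  have h1 : ∀ i, blockWeight h i (x i) =
      ∑ j, (k : ℝ)⁻¹ * ∏ l, h (i, l) (x i && decide (j = l)) := by
    intro i
    rw [← Finset.mul_sum]
    cases x i <;> simp [blockWeight, slotWeight, hk0]
  simp_rw [h1]
  rw [Finset.prod_univ_sum, Fintype.piFinset_univ]
  refine Finset.sum_congr rfl fun J _ => ?_
  rw [Finset.prod_mul_distrib, Finset.prod_const, Finset.card_univ, Fintype.prod_prod_type]

theorem slotWeight_nonneg {h : ι × Fin k → Bool → ℝ} (hh : ∀ p b, 0 ≤ h p b) (i : ι)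
    (j : Fin k) : 0 ≤ slotWeight h i j :=
  Finset.prod_nonneg fun _ _ => hh _ _

theorem blockWeight_nonneg {h : ι × Fin k → Bool → ℝ} (hh : ∀ p b, 0 ≤ h p b) (i : ι)
    (b : Bool) : 0 ≤ blockWeight h i b := by
  unfold blockWeight
  split_ifs
  · exact mul_nonneg (by positivity) (Finset.sum_nonneg fun j _ => slotWeight_nonneg hh i j)
  · exact Finset.prod_nonneg fun _ _ => hh _ _

theorem blockWeight_mono {h h' : ι × Fin k → Bool → ℝ} (hh : ∀ p b, 0 ≤ h p b)
    (hle : ∀ p b, h p b ≤ h' p b) (i : ι) (b : Bool) : blockWeight h i b ≤ blockWeight h' i b := by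
  unfold blockWeight
  split_ifs
  · refine mul_le_mul_of_nonneg_left (Finset.sum_le_sum fun j _ => ?_) (by positivity)
    exact Finset.prod_le_prod (fun _ _ => hh _ _) fun _ _ => hle _ _
  · exact Finset.prod_le_prod (fun _ _ => hh _ _) fun _ _ => hle _ _

theorem slotWeight_mul (h h' : ι × Fin k → Bool → ℝ) (i : ι) (j : Fin k) :
    slotWeight (h * h') i j = slotWeight h i j * slotWeight h' i j :=
  Finset.prod_mul_distrib

theorem slotWeight_spinWeight (p : ι × Fin k) (b : Bool) (i : ι) (j : Fin k) :
    slotWeight (spinWeight p b) i j = if i = p.1 ∧ decide (j = p.2) ≠ b then 0 else 1 := by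
  obtain ⟨i', j'⟩ := p
  unfold slotWeight
  rw [Finset.prod_eq_single j']
  · simp [spinWeight]
  · intro l _ hl
    simp [spinWeight, hl]
  · simp

theorem blockWeight_mul_spinWeight_of_ne (h : ι × Fin k → Bool → ℝ) (p : ι × Fin k) (b : Bool)
    {i : ι} (hi : i ≠ p.1) (c : Bool) :
    blockWeight (h * spinWeight p b) i c = blockWeight h i c := by
  have : ∀ l, spinWeight p b (i, l) = 1 := by
    intro l
    funext c
    have : (i, l) ≠ p := fun hc => hi (congrArg Prod.fst hc)
    simp [spinWeight, this]
  simp [blockWeight, slotWeight, Pi.mul_apply, this]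

theorem blockWeight_mul_spinWeight_true (h : ι × Fin k → Bool → ℝ) (i : ι) (j : Fin k) :
    blockWeight (h * spinWeight (i, j) true) i true = (k : ℝ)⁻¹ * slotWeight h i j := by
  simp only [blockWeight, if_true, slotWeight_mul, slotWeight_spinWeight]
  congr 1
  rw [Finset.sum_eq_single j]
  · simp
  · intro l _ hl
    simp [hl]
  · simp

theorem blockWeight_mul_spinWeight_true_false (h : ι × Fin k → Bool → ℝ) (i : ι) (j : Fin k) :
    blockWeight (h * spinWeight (i, j) true) i false = 0 := by
  simp only [blockWeight, Bool.false_eq_true, if_false]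
  exact Finset.prod_eq_zero (Finset.mem_univ j) (by simp [spinWeight])

/-- The conditional probability that the `+1` of the block of `p` sits at `p`. -/
def slotProb (h : ι × Fin k → Bool → ℝ) (p : ι × Fin k) : ℝ :=
  slotWeight h p.1 p.2 / ∑ j, slotWeight h p.1 j

theorem slotProb_nonneg {h : ι × Fin k → Bool → ℝ} (hh : ∀ p b, 0 ≤ h p b) (p : ι × Fin k) :
    0 ≤ slotProb h p :=
  div_nonneg (slotWeight_nonneg hh _ _) (Finset.sum_nonneg fun _ _ => slotWeight_nonneg hh _ _)

theorem sum_slotProb_le_one (h : ι × Fin k → Bool → ℝ) (i : ι) :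
    ∑ j, slotProb h (i, j) ≤ 1 := by
  simp only [slotProb]
  rw [← Finset.sum_div]
  exact div_self_le_one _

/-- Only the factor of the block of `p` changes: a `+1` at `p` forces the block to be `+1` and
selects one slot. The free factor `f` lets a second site be treated in turn. -/
theorem totalWeight_blockWeight_spin {h : ι × Fin k → Bool → ℝ} (hh : ∀ p b, 0 ≤ h p b)
    (μ : PMF (ι → Bool)) (p : ι × Fin k) (f : ι → Bool → ℝ) :
    totalWeight μ (blockWeight (h * spinWeight p true) * f) =
      slotProb h p * totalWeight μ (blockWeight h * (spinWeight p.1 true * f)) := by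
  unfold totalWeight
  rw [Finset.mul_sum]
  refine Finset.sum_congr rfl fun x _ => ?_
  rw [mul_left_comm]
  congr 1
  rw [← Finset.mul_prod_erase _ _ (Finset.mem_univ p.1),
    ← Finset.mul_prod_erase _ _ (Finset.mem_univ p.1), ← mul_assoc]
  congr 1
  · obtain ⟨i, j⟩ := p
    simp only [Pi.mul_apply]
    cases x i
    · rw [blockWeight_mul_spinWeight_true_false]
      simp [spinWeight]
    · rw [blockWeight_mul_spinWeight_true]
      have h1 : slotWeight h i j = slotProb h (i, j) * ∑ l, slotWeight h i l := by
        -- If the denominator vanishes, so does every slot weight, by nonnegativity; the default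
        -- value of division does no harm.
        unfold slotProb
        by_cases h0 : ∑ l, slotWeight h i l = 0
        · rw [h0, mul_zero]
          exact (Finset.sum_eq_zero_iff_of_nonneg fun l _ => slotWeight_nonneg hh i l).1 h0 j
            (Finset.mem_univ j)
        · rw [div_mul_cancel₀ _ h0]
      rw [h1]
      simp only [blockWeight, spinWeight, if_true]
      simp
      ring
  · refine Finset.prod_congr rfl fun i hi => ?_
    have hne := Finset.ne_of_mem_erase hi
    simp only [Pi.mul_apply]
    rw [blockWeight_mul_spinWeight_of_ne _ _ _ hne]
    simp [spinWeight, hne]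

variable {μ M : PMF (ι → Bool)} {hk : 1 ≤ k} {h : ι × Fin k → Bool → ℝ}
  {N : PMF (ι × Fin k → Bool)}

theorem plusProb_of_isTilt_kTransform (hh : ∀ p b, 0 ≤ h p b)
    (hN : IsTilt (kTransform μ k hk) h N) (hM : IsTilt μ (blockWeight h) M) (p : ι × Fin k) :
    plusProb N p = slotProb h p * plusProb M p.1 := by
  have h1 := hN.totalWeight_eq (spinWeight p true)
  have h2 := hM.totalWeight_eq (spinWeight p.1 true)
  have h3 := totalWeight_blockWeight_spin hh μ p 1
  rw [mul_one, mul_one] at h3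
  rw [totalWeight_kTransform, totalWeight_kTransform, h3, ← h2, ← mul_assoc] at h1
  exact mul_right_cancel₀ hM.totalWeight_ne_zero h1

theorem slotProb_mul_spinWeight (h : ι × Fin k → Bool → ℝ) {p q : ι × Fin k} (hpq : p.1 ≠ q.1) :
    slotProb (h * spinWeight p true) q = slotProb h q := by
  simp [slotProb, slotWeight_mul, slotWeight_spinWeight, hpq.symm]

theorem plusProb₂_of_isTilt_kTransform (hh : ∀ p b, 0 ≤ h p b)
    (hN : IsTilt (kTransform μ k hk) h N) (hM : IsTilt μ (blockWeight h) M) {p q : ι × Fin k}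
    (hpq : p.1 ≠ q.1) :
    plusProb₂ N p q = slotProb h p * slotProb h q * plusProb₂ M p.1 q.1 := by
  have h1 := hN.totalWeight_eq (spinWeight p true * spinWeight q true)
  have h2 := hM.totalWeight_eq (spinWeight p.1 true * spinWeight q.1 true)
  have hh' : ∀ p' b, 0 ≤ (h * spinWeight p true) p' b := fun p' b =>
    mul_nonneg (hh p' b) (spinWeight_nonneg _ _ _ _)
  have h3 := totalWeight_blockWeight_spin hh' μ q 1
  have h4 := totalWeight_blockWeight_spin hh μ p (spinWeight q.1 true)
  rw [mul_one, mul_one, slotProb_mul_spinWeight h hpq] at h3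
  rw [totalWeight_kTransform, totalWeight_kTransform, ← mul_assoc, h3, h4, ← h2] at h1
  refine mul_right_cancel₀ hM.totalWeight_ne_zero (h1.trans ?_)
  rw [plusProb₂]
  ring

/-- A block carries at most one `+1`. -/
theorem plusProb₂_of_isTilt_kTransform_eq_zero
    (hN : IsTilt (kTransform μ k hk) h N) {i : ι} {j l : Fin k} (hjl : j ≠ l) :
    plusProb₂ N (i, j) (i, l) = 0 := by
  have h1 := hN.totalWeight_eq (spinWeight (i, j) true * spinWeight (i, l) true)
  have h0 : totalWeight μ (blockWeight
      (h * (spinWeight (i, j) true * spinWeight (i, l) true))) = 0 := by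
    refine Finset.sum_eq_zero fun x _ => mul_eq_zero_of_right _ ?_
    refine Finset.prod_eq_zero (Finset.mem_univ i) ?_
    rw [← mul_assoc]
    cases x i
    · exact blockWeight_mul_spinWeight_true_false _ _ _
    · rw [blockWeight_mul_spinWeight_true, slotWeight_mul, slotWeight_spinWeight]
      simp [hjl.symm]
  rw [totalWeight_kTransform (h := h * _), h0] at h1
  exact (mul_eq_zero.1 h1).resolve_right hN.totalWeight_ne_zero

/-! ### Influence bounds for the k-transformation. -/

theorem abs_div_sub_div_le {p x y z : ℝ} (hp1 : p ≤ 1) (hx0 : 0 < x)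
    (hx1 : x < 1) : |z / x - (y - p * z) / (1 - p * x)| ≤ |z / x - (y - z) / (1 - x)| := by
  have hpx : p * x ≤ x := mul_le_of_le_one_left hx0.le hp1
  have h1 : 0 < 1 - x := by linarith
  have h2 : 0 < 1 - p * x := by linarith
  -- Both differences have the covariance z - x y as numerator, and thinning by p only enlarges the
  -- denominator.
  have e1 : z / x - (y - p * z) / (1 - p * x) = (z - x * y) / (x * (1 - p * x)) := by
    rw [div_sub_div _ _ hx0.ne' h2.ne']
    congr 1
    ring
  have e2 : z / x - (y - z) / (1 - x) = (z - x * y) / (x * (1 - x)) := by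
    rw [div_sub_div _ _ hx0.ne' h1.ne']
    congr 1
    ring
  rw [e1, e2, abs_div, abs_div, abs_of_pos (mul_pos hx0 h2), abs_of_pos (mul_pos hx0 h1)]
  refine div_le_div_of_nonneg_left (abs_nonneg _) (mul_pos hx0 h1) ?_
  exact mul_le_mul_of_nonneg_left (by linarith) hx0.le

theorem slotProb_le_one (hh : ∀ p b, 0 ≤ h p b) (p : ι × Fin k) : slotProb h p ≤ 1 :=
  (Finset.single_le_sum (f := fun j => slotProb h (p.1, j))
    (fun _ _ => slotProb_nonneg hh _) (Finset.mem_univ p.2)).trans (sum_slotProb_le_one h p.1)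

/-- A `+1` at `p` says exactly that the block of `p` is `+1`, whereas a `-1` at `p` leaves the block
undecided, which weakens the influence. The slot in the block of `q` is chosen independently and
contributes its probability as a factor. -/
theorem maxInfluence_kTransform_le (hh : ∀ p b, 0 ≤ h p b)
    (hN : IsTilt (kTransform μ k hk) h N) (hM : IsTilt μ (blockWeight h) M) {p q : ι × Fin k}
    (hpq : p.1 ≠ q.1) :
    maxInfluence N p q ≤ maxInfluence M p.1 q.1 * slotProb h q := by
  have hq0 := slotProb_nonneg hh q
  refine maxInfluence_le (mul_nonneg (maxInfluence_nonneg _ _) hq0) fun h0 h1 => ?_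
  rw [plusProb₂_of_isTilt_kTransform hh hN hM hpq, plusProb_of_isTilt_kTransform hh hN hM,
    plusProb_of_isTilt_kTransform hh hN hM q]
  rw [plusProb_of_isTilt_kTransform hh hN hM] at h0 h1
  have hp0 := slotProb_nonneg hh p
  have hp1 := slotProb_le_one hh p
  set x := plusProb M p.1
  set y := plusProb M q.1
  set z := plusProb₂ M p.1 q.1
  set r := slotProb h p
  set s := slotProb h q
  have hx0 : 0 < x := pos_of_mul_pos_right h0 hp0
  have hr0 : 0 < r := pos_of_mul_pos_left h0 hx0.le
  have e : r * s * z / (r * x) - (s * y - r * s * z) / (1 - r * x) =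
      s * (z / x - (y - r * z) / (1 - r * x)) := by
    have : 1 - r * x ≠ 0 := by linarith
    field_simp
  rw [e, abs_mul, abs_of_nonneg hq0, mul_comm]
  refine mul_le_mul_of_nonneg_right ?_ hq0
  rcases (plusProb_le_one (μ := M) p.1).lt_or_eq with hx1 | hx1
  · exact (abs_div_sub_div_le hp1 hx0 hx1).trans (le_maxInfluence hx0 hx1)
  -- The block of `p` is almost surely `+1` under M, where the influence formula for M divides by
  -- zero; the slot at `p` then carries no information about `q`.
  · have hzy : z = y := by
      have e1 := totalWeight_spin_false_true (μ := M) p.1 q.1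
      have e2 : totalWeight M (spinWeight p.1 false * spinWeight q.1 true) ≤
          totalWeight M (spinWeight p.1 false) := by
        refine totalWeight_mono (fun _ _ => mul_nonneg (spinWeight_nonneg _ _ _ _)
          (spinWeight_nonneg _ _ _ _)) fun i b => mul_le_of_le_one_right
          (spinWeight_nonneg _ _ _ _) ?_
        unfold spinWeight; split_ifs <;> norm_num
      rw [totalWeight_spin_false, e1] at e2
      have e3 := plusProb₂_le (μ := M) p.1 q.1
      change y - z ≤ 1 - x at e2
      change z ≤ y at e3
      change x = 1 at hx1
      linarith
    have hx1' : x = 1 := hx1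
    have h3 : 1 - r ≠ 0 := by
      rw [hx1', mul_one] at h1
      exact (sub_pos.2 h1).ne'
    have : z / x - (y - r * z) / (1 - r * x) = 0 := by
      rw [hx1', hzy, mul_one, div_one, sub_eq_zero, eq_div_iff h3]
      ring
    rw [this, abs_zero]
    exact maxInfluence_nonneg _ _

/-- With r, s the slot probabilities and x the probability of a `+1` block, exclusivity makes the
influence s x / (1 - r x), which increases in x up to s / (1 - r). The product form stays meaningful
when r = 1. -/
theorem maxInfluence_kTransform_block_le (hh : ∀ p b, 0 ≤ h p b)
    (hN : IsTilt (kTransform μ k hk) h N) (hM : IsTilt μ (blockWeight h) M) {i : ι}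
    {j l : Fin k} (hjl : j ≠ l) :
    maxInfluence N (i, j) (i, l) * (1 - slotProb h (i, j)) ≤ slotProb h (i, l) := by
  have hj1 := slotProb_le_one hh (i, j)
  rcases hj1.lt_or_eq with hj1 | hj1
  swap
  · rw [hj1, sub_self, mul_zero]; exact slotProb_nonneg hh _
  rw [← le_div_iff₀ (by linarith)]
  refine maxInfluence_le (div_nonneg (slotProb_nonneg hh _) (by linarith)) fun h0 h1 => ?_
  rw [plusProb₂_of_isTilt_kTransform_eq_zero hN hjl, plusProb_of_isTilt_kTransform hh hN hM,
    plusProb_of_isTilt_kTransform hh hN hM (i, l)]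
  have hj0 := slotProb_nonneg hh (i, j)
  have hl0 := slotProb_nonneg hh (i, l)
  have hx0 := plusProb_nonneg (μ := M) i
  have hx1 := plusProb_le_one (μ := M) i
  set x := plusProb M i
  set r := slotProb h (i, j)
  set s := slotProb h (i, l)
  change |0 / (r * x) - (s * x - 0) / (1 - r * x)| ≤ s / (1 - r)
  have hd : 0 < 1 - r * x := by nlinarith
  rw [zero_div, sub_zero, zero_sub, abs_neg, abs_of_nonneg (by positivity), div_le_div_iff₀ hd
    (by linarith)]
  nlinarith [mul_nonneg hl0 (sub_nonneg.2 hx1)]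

theorem maxInfluence_le_one {κ : Type*} [Fintype κ] [DecidableEq κ] {M : PMF (κ → Bool)} (i j : κ) :
    maxInfluence M i j ≤ 1 := by
  refine maxInfluence_le zero_le_one fun h0 h1 => ?_
  have a1 : plusProb₂ M i j / plusProb M i ≤ 1 :=
    div_le_one_of_le₀ (by rw [plusProb₂_comm]; exact plusProb₂_le j i) h0.le
  have a0 : 0 ≤ plusProb₂ M i j / plusProb M i := div_nonneg (plusProb₂_nonneg i j) h0.le
  have b0 : 0 ≤ (plusProb M j - plusProb₂ M i j) / (1 - plusProb M i) :=
    div_nonneg (sub_nonneg.2 (plusProb₂_le i j)) (by linarith)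
  have b1 : (plusProb M j - plusProb₂ M i j) / (1 - plusProb M i) ≤ 1 := by
    refine div_le_one_of_le₀ ?_ (by linarith)
    rw [← totalWeight_spin_false_true, ← totalWeight_spin_false]
    refine totalWeight_mono (fun _ _ => mul_nonneg (spinWeight_nonneg _ _ _ _)
      (spinWeight_nonneg _ _ _ _)) fun i b => mul_le_of_le_one_right
      (spinWeight_nonneg _ _ _ _) ?_
    unfold spinWeight; split_ifs <;> norm_num
  rw [abs_le]
  constructor <;> linarith

/-- The diagonal entry is at most 1. The others are at most s_l / (1 - r), and the s_l with l ≠ j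
sum to at most 1 - r. -/
theorem sum_block_maxInfluence_le (hh : ∀ p b, 0 ≤ h p b)
    (hN : IsTilt (kTransform μ k hk) h N) (hM : IsTilt μ (blockWeight h) M) (i : ι)
    (j : Fin k) : ∑ l, maxInfluence N (i, j) (i, l) ≤ 2 := by
  rw [← Finset.add_sum_erase _ _ (Finset.mem_univ j)]
  have h1 := maxInfluence_le_one (M := N) (i, j) (i, j)
  suffices h2 : ∑ l ∈ Finset.univ.erase j, maxInfluence N (i, j) (i, l) ≤ 1 by linarith
  have hs := sum_slotProb_le_one h i
  rw [← Finset.add_sum_erase _ _ (Finset.mem_univ j)] at hs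
  have hj1 := slotProb_le_one hh (i, j)
  rcases hj1.lt_or_eq with hj1 | hj1
  · refine le_of_mul_le_mul_right ?_ (sub_pos.2 hj1)
    rw [Finset.sum_mul, one_mul]
    calc _ ≤ ∑ l ∈ Finset.univ.erase j, slotProb h (i, l) :=
          Finset.sum_le_sum fun l hl =>
            maxInfluence_kTransform_block_le hh hN hM (Finset.ne_of_mem_erase hl).symm
      _ ≤ _ := by linarith
  -- When r = 1 the other slots have probability zero, hence constant spins that cannot be
  -- influenced.
  · rw [Finset.sum_eq_zero]
    · exact zero_le_one
    intro l hl
    have hjl := (Finset.ne_of_mem_erase hl).symm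
    have hl0 : slotProb h (i, l) = 0 := by
      have h3 : slotProb h (i, l) ≤ ∑ l ∈ Finset.univ.erase j, slotProb h (i, l) :=
        Finset.single_le_sum (f := fun l => slotProb h (i, l))
          (fun _ _ => slotProb_nonneg hh _) hl
      have := slotProb_nonneg hh (i, l)
      linarith
    refine le_antisymm (maxInfluence_le le_rfl fun _ _ => ?_) (maxInfluence_nonneg _ _)
    rw [plusProb₂_of_isTilt_kTransform_eq_zero hN hjl,
      plusProb_of_isTilt_kTransform hh hN hM (i, l), hl0]
    simp

end KTransform

end SpinDist

end

noncomputable section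

namespace SpinDist

/-! ### Spectral independence of the k-transformation. -/

section Main

variable {ι : Type*} [Fintype ι] [DecidableEq ι] {k : ℕ} {μ : PMF (ι → Bool)} {hk : 1 ≤ k}

/-- Unless the block is forced to be `+1`, all its `-1` weights equal 1, and the induced field is an
average over slots of single `+1` weights. -/
theorem blockWeight_true_le {h : ι × Fin k → Bool → ℝ} (hk : 1 ≤ k) (hh : ∀ p b, 0 ≤ h p b)
    {B : ℝ} (hB : ∀ p, h p true ≤ B) (hf : ∀ p, h p false = 0 ∨ h p false = 1) (i : ι) :
    blockWeight h i true ≤ B * blockWeight h i false ∨ blockWeight h i false = 0 := by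
  by_cases h0 : blockWeight h i false = 0
  · exact Or.inr h0
  left
  rw [blockWeight_false] at h0
  have h1 : ∀ l, h (i, l) false = 1 := fun l =>
    (hf (i, l)).resolve_left (Finset.prod_ne_zero_iff.1 h0 l (Finset.mem_univ l))
  have h2 : blockWeight h i false = 1 :=
    (blockWeight_false h i).trans (Finset.prod_eq_one fun l _ => h1 l)
  have h3 : ∀ j, slotWeight h i j ≤ B := by
    intro j
    calc slotWeight h i j ≤ ∏ l, if j = l then B else 1 := by
          refine Finset.prod_le_prod (fun _ _ => hh _ _) fun l _ => ?_
          split_ifs with hl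
          · simpa [hl] using hB (i, l)
          · simpa [hl] using (h1 l).le
      _ = B := by simp
  have hk0 : (0 : ℝ) < k := by positivity
  rw [h2, mul_one]
  change (k : ℝ)⁻¹ * ∑ j, slotWeight h i j ≤ B
  rw [inv_mul_le_iff₀ hk0]
  calc ∑ j, slotWeight h i j ≤ ∑ _j : Fin k, B := Finset.sum_le_sum fun j _ => h3 j
    _ = k * B := by simp

theorem exists_ne_zero_of_totalWeight_ne_zero {g : ι → Bool → ℝ} (h : totalWeight μ g ≠ 0) :
    ∃ x, μ x ≠ 0 ∧ ∀ i, g i (x i) ≠ 0 := by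
  obtain ⟨x, -, hx⟩ := Finset.exists_ne_zero_of_sum_ne_zero h
  refine ⟨x, fun h0 => ?_, fun i => ?_⟩
  · rw [h0] at hx; simp at hx
  · exact Finset.prod_ne_zero_iff.1 (right_ne_zero_of_mul hx) i (Finset.mem_univ i)

theorem pinWeight_eq_zero_or_one {Λ : Finset ι} (σ : Λ → Bool) (i : ι) (b : Bool) :
    pinWeight σ i b = 0 ∨ pinWeight σ i b = 1 := by
  unfold pinWeight; split_ifs <;> simp

/-- Slot probabilities collapse every foreign block to one entry of the influence matrix of M; the
own block contributes the additional 2. -/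
theorem sum_influence_kTransform_le (d : Diagonal) {h : ι × Fin k → Bool → ℝ}
    {N : PMF (ι × Fin k → Bool)} {M : PMF (ι → Bool)} (hh : ∀ p b, 0 ≤ h p b)
    (hN : IsTilt (kTransform μ k hk) h N) (hM : IsTilt μ (blockWeight h) M) {v : ι → ℝ}
    (hv : ∀ i, 0 < v i) {θ : ℝ} (hvM : ∀ i, ∑ j, influence d M i j * v j ≤ θ * v i)
    (p : ι × Fin k) : ∑ q, influence d N p q * v q.1 ≤ (θ + 2) * v p.1 := by
  rw [Fintype.sum_prod_type]
  have key : ∀ i, ∑ l, influence d N p (i, l) * v i ≤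
      influence d M p.1 i * v i + if p.1 = i then 2 * v i else 0 := by
    intro i
    rw [← Finset.sum_mul]
    split_ifs with hi
    · subst hi
      rw [← add_mul]
      refine mul_le_mul_of_nonneg_right ?_ (hv _).le
      have h1 := sum_block_maxInfluence_le hh hN hM p.1 p.2
      have h2 : ∑ l, influence d N p (p.1, l) ≤ ∑ l, maxInfluence N (p.1, p.2) (p.1, l) :=
        Finset.sum_le_sum fun l _ => influence_le d _ _
      have h3 := influence_nonneg (μ := M) d p.1 p.1
      linarith
    · rw [add_zero, influence_of_ne d hi]
      refine mul_le_mul_of_nonneg_right ?_ (hv _).le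
      calc ∑ l, influence d N p (i, l) ≤ ∑ l, maxInfluence M p.1 i * slotProb h (i, l) :=
            Finset.sum_le_sum fun l _ => (influence_le d _ _).trans
              (maxInfluence_kTransform_le hh hN hM hi)
        _ ≤ maxInfluence M p.1 i := by
            rw [← Finset.mul_sum]
            exact mul_le_of_le_one_right (maxInfluence_nonneg _ _) (sum_slotProb_le_one h i)
  calc _ ≤ ∑ i, (influence d M p.1 i * v i + if p.1 = i then 2 * v i else 0) :=
        Finset.sum_le_sum fun i _ => key i
    _ = ∑ i, influence d M p.1 i * v i + 2 * v p.1 := by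
        rw [Finset.sum_add_distrib]; simp
    _ ≤ _ := by linarith [hvM p.1]

theorem spectrallyIndependent_kTransform (d : Diagonal) {η θ B : ℝ} (hη : 0 ≤ η) (hθ : η < θ)
    (hB : 1 ≤ B)
    (hμ : ∀ (lam : ι → ℝ) (hlam : ∀ i, 0 < lam i), (∀ i, lam i ≤ B) →
      SpectrallyIndependent d η (magnetize lam hlam μ))
    (lam : ι × Fin k → ℝ) (hlam : ∀ p, 0 < lam p) (hlamB : ∀ p, lam p ≤ B) :
    SpectrallyIndependent d (θ + 2) (magnetize lam hlam (kTransform μ k hk)) := by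
  intro Λ σ hσ
  have hN := (isTilt_magnetize (μ := kTransform μ k hk) lam hlam).trans (isTilt_pin σ hσ)
  set h := siteField lam * pinWeight σ with hdef
  have hh : ∀ p b, 0 ≤ h p b := fun p b =>
    mul_nonneg (siteField_pos hlam p b).le (pinWeight_nonneg σ p b)
  have hw := hN.totalWeight_ne_zero
  rw [totalWeight_kTransform] at hw
  obtain ⟨x, hx, hgx⟩ := exists_ne_zero_of_totalWeight_ne_zero hw
  have hg0 := blockWeight_nonneg hh
  have hM := isTilt_pin_magnetize hg0 x hx hgx
  have hlegal := blockWeight_true_le (B := B) hk hh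
    (fun p => (mul_le_of_le_one_right (hlam p).le (pinWeight_le_one σ p true)).trans (hlamB p))
    (fun p => by simpa [hdef, siteField] using pinWeight_eq_zero_or_one σ p false)
  have hSI := hμ (fieldOf (blockWeight h)) (fieldOf_pos hg0) (fieldOf_le hg0 hB hlegal)
    (frozenSites (blockWeight h)) ((frozenSites (blockWeight h)).restrict x)
    (restrict_mem_support_marginalOn _ x (magnetize_ne_zero _ _ hx))
  obtain ⟨v, hv, hvM⟩ := exists_pos_mulVec_le (influence_nonneg d) hη hθ hSI
  exact spectralRadius_le_of_mulVec_le (influence_nonneg d) (w := fun p => v p.1)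
    (fun p => hv p.1) (sum_influence_kTransform_le d hh hN hM hv hvM)

/-! ### Marginal stability of the k-transformation. -/

theorem marginal_eq_ofReal (i : ι) (b : Bool) :
    marginal μ i b = ENNReal.ofReal (totalWeight μ (spinWeight i b)) := by
  rw [← toReal_marginal, ENNReal.ofReal_toReal (PMF.apply_ne_top _ _)]

theorem marginalRatio_le_iff {ζ : ℝ} (hζ : 0 < ζ) (i : ι) :
    marginalRatio μ i ≤ ENNReal.ofReal ζ ↔
      totalWeight μ (spinWeight i true) ≤ ζ * totalWeight μ (spinWeight i false) := by
  have h0 : ENNReal.ofReal ζ ≠ 0 := (ENNReal.ofReal_pos.2 hζ).ne'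
  rw [marginalRatio, ENNReal.div_le_iff_le_mul (Or.inr ENNReal.ofReal_ne_top) (Or.inr h0),
    marginal_eq_ofReal, marginal_eq_ofReal, ← ENNReal.ofReal_mul hζ.le,
    ENNReal.ofReal_le_ofReal_iff (mul_nonneg hζ.le (totalWeight_nonneg (spinWeight_nonneg _ _)))]

/-- Otherwise both spins would have probability zero. This excludes infinite ratios before passing
from `ℝ≥0∞` to the reals. -/
theorem totalWeight_spin_false_pos {ζ : ℝ} {i : ι}
    (h : totalWeight μ (spinWeight i true) ≤ ζ * totalWeight μ (spinWeight i false)) :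
    0 < totalWeight μ (spinWeight i false) := by
  refine lt_of_le_of_ne (totalWeight_nonneg (spinWeight_nonneg _ _)) fun h0 => ?_
  have h1 := totalWeight_spin_false (μ := μ) i
  have h2 : plusProb μ i ≤ _ := h
  rw [← h0, mul_zero] at h2
  linarith

theorem marginalRatio_le_mul_iff {μ' : PMF (ι → Bool)} {ζ : ℝ} (hζ : 0 < ζ) {i : ι}
    (h : 0 < totalWeight μ (spinWeight i false))
    (h' : 0 < totalWeight μ' (spinWeight i false)) :
    marginalRatio μ i ≤ ENNReal.ofReal ζ * marginalRatio μ' i ↔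
      totalWeight μ (spinWeight i true) * totalWeight μ' (spinWeight i false) ≤
        ζ * totalWeight μ' (spinWeight i true) * totalWeight μ (spinWeight i false) := by
  have hn : 0 ≤ totalWeight μ' (spinWeight i true) := totalWeight_nonneg (spinWeight_nonneg _ _)
  rw [marginalRatio, marginalRatio, marginal_eq_ofReal, marginal_eq_ofReal, marginal_eq_ofReal,
    marginal_eq_ofReal, ← ENNReal.ofReal_div_of_pos h, ← ENNReal.ofReal_div_of_pos h',
    ← ENNReal.ofReal_mul hζ.le,
    ENNReal.ofReal_le_ofReal_iff (mul_nonneg hζ.le (div_nonneg hn h'.le)), ← mul_div_assoc,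
    div_le_div_iff₀ h h']

theorem IsTilt.totalWeight_pos {g : ι → Bool → ℝ} {M : PMF (ι → Bool)} (hM : IsTilt μ g M)
    (hg : ∀ i b, 0 ≤ g i b) : 0 < totalWeight μ g :=
  lt_of_le_of_ne (totalWeight_nonneg hg) hM.totalWeight_ne_zero.symm

theorem ratio_le_iff_of_isTilt {g : ι → Bool → ℝ} {M : PMF (ι → Bool)} (hM : IsTilt μ g M)
    (hg : ∀ i b, 0 ≤ g i b) (ζ : ℝ) (i : ι) :
    totalWeight M (spinWeight i true) ≤ ζ * totalWeight M (spinWeight i false) ↔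
      totalWeight μ (g * spinWeight i true) ≤ ζ * totalWeight μ (g * spinWeight i false) := by
  rw [← hM.totalWeight_eq, ← hM.totalWeight_eq, ← mul_assoc,
    mul_le_mul_iff_left₀ (hM.totalWeight_pos hg)]

theorem ratio_le_mul_iff_of_isTilt {g g' : ι → Bool → ℝ} {M M' : PMF (ι → Bool)}
    (hM : IsTilt μ g M) (hM' : IsTilt μ g' M') (hg : ∀ i b, 0 ≤ g i b)
    (hg' : ∀ i b, 0 ≤ g' i b) (ζ : ℝ) (i : ι) :
    totalWeight M (spinWeight i true) * totalWeight M' (spinWeight i false) ≤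
        ζ * totalWeight M' (spinWeight i true) * totalWeight M (spinWeight i false) ↔
      totalWeight μ (g * spinWeight i true) * totalWeight μ (g' * spinWeight i false) ≤
        ζ * totalWeight μ (g' * spinWeight i true) * totalWeight μ (g * spinWeight i false) := by
  have hpos := mul_pos (hM.totalWeight_pos hg) (hM'.totalWeight_pos hg')
  rw [← hM.totalWeight_eq, ← hM.totalWeight_eq, ← hM'.totalWeight_eq, ← hM'.totalWeight_eq,
    ← mul_le_mul_iff_left₀ hpos]
  constructor <;> intro h <;> nlinarith [h]

theorem totalWeight_pin_erase (x : ι → Bool) (i : ι) (b : Bool) :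
    totalWeight μ (pinWeight ((Finset.univ.erase i).restrict x) * spinWeight i b) =
      (μ (Function.update x i b)).toReal := by
  rw [totalWeight_mul_spinWeight]
  simp only [prod_pinWeight]
  rw [Finset.sum_eq_single (Function.update x i b)]
  · rw [if_pos (by simp), if_pos, mul_one]
    funext j
    have hj := Finset.ne_of_mem_erase j.2
    simp [Function.update_of_ne hj]
  · intro y _ hy
    split_ifs with h1 h2
    · refine absurd ?_ hy
      funext j
      by_cases hj : j = i
      · subst hj; simp [h1]
      · rw [Function.update_of_ne hj]
        exact congrFun h2 ⟨j, Finset.mem_erase.2 ⟨hj, Finset.mem_univ j⟩⟩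
    · rw [mul_zero]
    · rfl
  · simp

/-- Marginal stability applied to the pinning of all other sites, compared with a tilt. -/
theorem update_ratio_le_of_ne_zero {ζ : ℝ} (hζ : 0 < ζ)
    (hμ : ∀ (lam : ι → ℝ) (hlam : ∀ i, 0 < lam i), (∀ i, lam i ≤ 1) →
      MarginallyStable ζ (magnetize lam hlam μ))
    {g : ι → Bool → ℝ} (hg0 : ∀ i b, 0 ≤ g i b)
    (hg : ∀ i, g i true ≤ 1 * g i false ∨ g i false = 0) {i : ι} (hi : g i = 1)
    {z : ι → Bool} (hz : μ z ≠ 0) (hgz : ∀ i, g i (z i) ≠ 0) :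
    (μ (Function.update z i true)).toReal ≤ ζ * (μ (Function.update z i false)).toReal ∧
    (μ (Function.update z i true)).toReal * totalWeight μ (g * spinWeight i false) ≤
      ζ * totalWeight μ (g * spinWeight i true) * (μ (Function.update z i false)).toReal := by
  have hS : frozenSites g ⊆ Finset.univ.erase i := by
    intro j hj
    refine Finset.mem_erase.2 ⟨fun hji => ?_, Finset.mem_univ j⟩
    subst hji
    simp [frozenSites, hi] at hj
  have hzM := magnetize_ne_zero (fieldOf g) (fieldOf_pos hg0) hz
  have hσ := restrict_mem_support_marginalOn (Finset.univ.erase i) z hzM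
  have hms := hμ (fieldOf g) (fieldOf_pos hg0) (fieldOf_le hg0 le_rfl hg)
  obtain ⟨h1, h2⟩ := hms i (frozenSites g) (Finset.univ.erase i) hS (by simp) _ hσ
  -- Stability with S = Λ serves only to make the ratio of the larger tilt finite.
  have h3 := (hms i (frozenSites g) (frozenSites g) subset_rfl
    (fun hc => by simpa using hS hc) _ (restrict_mem_support_marginalOn _ z hzM)).1
  have hM' := isTilt_pin_magnetize hg0 z hz hgz
  -- Fields on pinned sites are mere constants and the field at `i` is 1, so the magnetization
  -- disappears from the full pinning.
  have hM : IsTilt μ (pinWeight ((Finset.univ.erase i).restrict z))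
      (pin (magnetize (fieldOf g) (fieldOf_pos hg0) μ) _ hσ) := by
    refine isTilt_pin_magnetize_of_field (pinWeight_nonneg _) _ _ _ (fun j hj => ?_) z
      (fun j => ?_) (fun j hj => ?_) hσ
    · obtain rfl : j = i := by simpa using hj
      simp [pinWeight, fieldOf, hi]
    · unfold pinWeight
      split_ifs with h1 h2
      · exact one_pos
      · exact absurd rfl h2
      · exact one_pos
    · simp [pinWeight, Finset.ne_of_mem_erase hj]
  rw [marginalRatio_le_iff hζ] at h1 h3
  have h2' : marginalRatio (pin (magnetize (fieldOf g) (fieldOf_pos hg0) μ) _ hσ) i ≤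
      ENNReal.ofReal ζ * marginalRatio (pin (magnetize (fieldOf g) (fieldOf_pos hg0) μ) _
        (restrict_mem_support_marginalOn (frozenSites g) z hzM)) i := h2
  rw [marginalRatio_le_mul_iff hζ (totalWeight_spin_false_pos h1)
    (totalWeight_spin_false_pos h3), ratio_le_mul_iff_of_isTilt hM hM' (pinWeight_nonneg _) hg0,
    totalWeight_pin_erase, totalWeight_pin_erase] at h2'
  rw [ratio_le_iff_of_isTilt hM (pinWeight_nonneg _), totalWeight_pin_erase,
    totalWeight_pin_erase] at h1
  exact ⟨h1, h2'⟩

theorem update_ratio_le {ζ : ℝ} (hζ : 0 < ζ)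
    (hμ : ∀ (lam : ι → ℝ) (hlam : ∀ i, 0 < lam i), (∀ i, lam i ≤ 1) →
      MarginallyStable ζ (magnetize lam hlam μ))
    {g : ι → Bool → ℝ} (hg0 : ∀ i b, 0 ≤ g i b)
    (hg : ∀ i, g i true ≤ 1 * g i false ∨ g i false = 0) {i : ι} (hi : g i = 1)
    {x : ι → Bool} (hgx : ∀ i, g i (x i) ≠ 0) :
    (μ (Function.update x i true)).toReal ≤ ζ * (μ (Function.update x i false)).toReal ∧
    (μ (Function.update x i true)).toReal * totalWeight μ (g * spinWeight i false) ≤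
      ζ * totalWeight μ (g * spinWeight i true) * (μ (Function.update x i false)).toReal := by
  have key : ∀ b, μ (Function.update x i b) ≠ 0 → _ := fun b hb =>
    update_ratio_le_of_ne_zero hζ hμ hg0 hg hi hb (fun j => by
      by_cases hj : j = i
      · subst hj; simp [hi]
      · rw [Function.update_of_ne hj]; exact hgx j)
  simp only [Function.update_idem] at key
  by_cases ht : μ (Function.update x i true) = 0
  · by_cases hf : μ (Function.update x i false) = 0
    · simp [ht, hf]
    · exact key false hf
  · exact key true ht

theorem totalWeight_mul_spin_of_eq_off {f g : ι → Bool → ℝ} {i : ι}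
    (hfg : ∀ j, j ≠ i → f j = g j) (b : Bool) :
    totalWeight μ (f * spinWeight i b) =
      f i b * totalWeight μ (Function.update g i 1 * spinWeight i b) := by
  rw [totalWeight_mul_spinWeight, totalWeight_mul_spinWeight, Finset.mul_sum]
  refine Finset.sum_congr rfl fun x _ => ?_
  split_ifs with hx
  · rw [mul_left_comm]
    congr 1
    rw [← Finset.mul_prod_erase _ _ (Finset.mem_univ i),
      ← Finset.mul_prod_erase _ (fun j => Function.update g i 1 j (x j)) (Finset.mem_univ i), hx]
    simp only [Function.update_self, Pi.one_apply, one_mul]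
    congr 1
    refine Finset.prod_congr rfl fun j hj => ?_
    rw [Function.update_of_ne (Finset.ne_of_mem_erase hj), hfg j (Finset.ne_of_mem_erase hj)]
  · rw [mul_zero]

theorem totalWeight_mul_spin_eq_sum_update {g : ι → Bool → ℝ} {i : ι} (hi : g i = 1)
    (b : Bool) : totalWeight μ (g * spinWeight i b) =
      ∑ x with x i = true, (μ (Function.update x i b)).toReal * ∏ j, g j (x j) := by
  rw [totalWeight_mul_spinWeight, ← Finset.sum_filter]
  refine Finset.sum_nbij' (fun x => Function.update x i true) (fun x => Function.update x i b)
    ?_ ?_ ?_ ?_ ?_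
  · intro x _; simp
  · intro x _; simp
  · intro x hx
    have : x i = b := (Finset.mem_filter.1 hx).2
    simp [← this]
  · intro x hx
    have : x i = true := (Finset.mem_filter.1 hx).2
    simp [← this]
  · intro x hx
    have : x i = b := (Finset.mem_filter.1 hx).2
    have h1 : Function.update (Function.update x i true) i b = x := by simp [← this]
    rw [h1]
    congr 1
    refine Finset.prod_congr rfl fun j _ => ?_
    by_cases hj : j = i
    · subst hj; simp [hi]
    · rw [Function.update_of_ne hj]

/-- Numerator and denominator of the `g`-ratio are sums over the same configurations off `i` with
the same weights, so it suffices to compare term by term. Each term is a full pinning compared with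
`g'`; `g ≤ g'` ensures that every configuration charged by `g` is allowed by `g'`. -/
theorem tilt_ratio_le {ζ : ℝ} (hζ : 0 < ζ)
    (hμ : ∀ (lam : ι → ℝ) (hlam : ∀ i, 0 < lam i), (∀ i, lam i ≤ 1) →
      MarginallyStable ζ (magnetize lam hlam μ))
    {g g' : ι → Bool → ℝ} (hg0 : ∀ i b, 0 ≤ g i b) (hle : ∀ i b, g i b ≤ g' i b)
    (hg' : ∀ i, g' i true ≤ 1 * g' i false ∨ g' i false = 0) {i : ι} (hi : g i = 1)
    (hi' : g' i = 1) :
    totalWeight μ (g * spinWeight i true) ≤ ζ * totalWeight μ (g * spinWeight i false) ∧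
    totalWeight μ (g * spinWeight i true) * totalWeight μ (g' * spinWeight i false) ≤
      ζ * totalWeight μ (g' * spinWeight i true) * totalWeight μ (g * spinWeight i false) := by
  have key : ∀ x : ι → Bool, ∏ j, g j (x j) ≠ 0 → _ := fun x hx =>
    update_ratio_le hζ hμ (fun i b => (hg0 i b).trans (hle i b)) hg' hi' (x := x) fun j =>
      ((lt_of_le_of_ne (hg0 _ _) (Finset.prod_ne_zero_iff.1 hx j (Finset.mem_univ j)).symm).trans_le
        (hle _ _)).ne'
  rw [totalWeight_mul_spin_eq_sum_update hi, totalWeight_mul_spin_eq_sum_update hi]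
  constructor
  · rw [Finset.mul_sum]
    refine Finset.sum_le_sum fun x _ => ?_
    by_cases hx : ∏ j, g j (x j) = 0
    · simp [hx]
    · rw [← mul_assoc]
      exact mul_le_mul_of_nonneg_right (key x hx).1 (Finset.prod_nonneg fun _ _ => hg0 _ _)
  · rw [Finset.mul_sum, Finset.sum_mul]
    refine Finset.sum_le_sum fun x _ => ?_
    by_cases hx : ∏ j, g j (x j) = 0
    · simp [hx]
    · rw [← mul_assoc, mul_right_comm]
      exact mul_le_mul_of_nonneg_right (key x hx).2 (Finset.prod_nonneg fun _ _ => hg0 _ _)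

/-- Since `(i, j)` is free, putting the `+1` there costs the same block weight as having no `+1` in
the block. -/
theorem totalWeight_kTransform_spin_true {h : ι × Fin k → Bool → ℝ} {i : ι} {j : Fin k}
    (hp : h (i, j) = 1) :
    totalWeight (kTransform μ k hk) (h * spinWeight (i, j) true) =
      (k : ℝ)⁻¹ * blockWeight h i false *
        totalWeight μ (Function.update (blockWeight h) i 1 * spinWeight i true) := by
  have hoff : ∀ l, l ≠ i → blockWeight (h * spinWeight (i, j) true) l = blockWeight h l :=
    fun l hl => funext fun c => blockWeight_mul_spinWeight_of_ne h (i, j) true hl c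
  rw [totalWeight_kTransform, ← totalWeight_spin_add i, totalWeight_mul_spin_of_eq_off hoff,
    totalWeight_mul_spin_of_eq_off hoff, blockWeight_mul_spinWeight_true,
    blockWeight_mul_spinWeight_true_false, zero_mul, add_zero]
  rw [blockWeight_false]
  congr 2
  refine Finset.prod_congr rfl fun l _ => ?_
  by_cases hl : j = l
  · subst hl; simp [hp]
  · simp [hl]

theorem totalWeight_kTransform_spin_false {h : ι × Fin k → Bool → ℝ} {i : ι} {j : Fin k} :
    totalWeight (kTransform μ k hk) (h * spinWeight (i, j) false) =
      blockWeight (h * spinWeight (i, j) false) i true *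
        totalWeight μ (Function.update (blockWeight h) i 1 * spinWeight i true) +
      blockWeight h i false *
        totalWeight μ (Function.update (blockWeight h) i 1 * spinWeight i false) := by
  have hoff : ∀ l, l ≠ i → blockWeight (h * spinWeight (i, j) false) l = blockWeight h l :=
    fun l hl => funext fun c => blockWeight_mul_spinWeight_of_ne h (i, j) false hl c
  rw [totalWeight_kTransform, ← totalWeight_spin_add i, totalWeight_mul_spin_of_eq_off hoff,
    totalWeight_mul_spin_of_eq_off hoff, blockWeight_false h,
    blockWeight_false (h * spinWeight (i, j) false)]
  congr 2
  refine Finset.prod_congr rfl fun l _ => ?_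
  simp [spinWeight]

theorem blockWeight_le_one {h : ι × Fin k → Bool → ℝ} (hh : ∀ p b, 0 ≤ h p b)
    (h1 : ∀ p b, h p b ≤ 1) (i : ι) (b : Bool) : blockWeight h i b ≤ 1 := by
  unfold blockWeight
  split_ifs
  · calc (k : ℝ)⁻¹ * ∑ j, slotWeight h i j ≤ (k : ℝ)⁻¹ * ∑ _j : Fin k, 1 := by
          refine mul_le_mul_of_nonneg_left (Finset.sum_le_sum fun j _ => ?_) (by positivity)
          exact Finset.prod_le_one (fun _ _ => hh _ _) fun _ _ => h1 _ _
      _ ≤ 1 := by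
          rw [Finset.sum_const, Finset.card_univ, Fintype.card_fin, nsmul_eq_mul, mul_one]
          exact inv_mul_le_one
  · exact Finset.prod_le_one (fun _ _ => hh _ _) fun _ _ => h1 _ _

theorem pinWeight_restrict₂_le {S Λ : Finset ι} (hS : S ⊆ Λ) (σ : Λ → Bool) (i : ι) (b : Bool) :
    pinWeight σ i b ≤ pinWeight (Finset.restrict₂ (π := fun _ => Bool) hS σ) i b := by
  by_cases hi : i ∈ S
  · simp only [pinWeight, hi, hS hi, dif_pos]
    exact le_rfl
  · have : pinWeight (Finset.restrict₂ (π := fun _ => Bool) hS σ) i b = 1 := by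
      simp [pinWeight, hi]
    rw [this]
    exact pinWeight_le_one σ i b

/-- If no site of the block is pinned to `+1`, the ratio at `p` is k⁻¹ a / (e a + b). Here a / b is
the ratio at `i` in μ tilted by the other blocks, and e ≤ 1 is the weight of a `+1` in another slot
of the same block. -/
theorem kTransform_ratio_le {ζ : ℝ} (hζ : 0 < ζ)
    (hμ : ∀ (lam : ι → ℝ) (hlam : ∀ i, 0 < lam i), (∀ i, lam i ≤ 1) →
      MarginallyStable ζ (magnetize lam hlam μ))
    {p : ι × Fin k} {S Λ : Finset (ι × Fin k)} (hS : S ⊆ Λ) (hp : p ∉ Λ) (σ : Λ → Bool) :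
    totalWeight (kTransform μ k hk) (pinWeight σ * spinWeight p true) ≤
      2 * ζ * totalWeight (kTransform μ k hk) (pinWeight σ * spinWeight p false) ∧
    totalWeight (kTransform μ k hk) (pinWeight σ * spinWeight p true) *
        totalWeight (kTransform μ k hk)
          (pinWeight (Finset.restrict₂ (π := fun _ => Bool) hS σ) * spinWeight p false) ≤
      2 * ζ * totalWeight (kTransform μ k hk)
          (pinWeight (Finset.restrict₂ (π := fun _ => Bool) hS σ) * spinWeight p true) *
        totalWeight (kTransform μ k hk) (pinWeight σ * spinWeight p false) := by
  obtain ⟨i, j⟩ := p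
  have hp' : (i, j) ∉ S := fun hc => hp (hS hc)
  have hle := pinWeight_restrict₂_le hS σ
  set τ := Finset.restrict₂ (π := fun _ => Bool) hS σ
  have hσp : pinWeight σ (i, j) = 1 := by funext b; simp [pinWeight, hp]
  have hτp : pinWeight τ (i, j) = 1 := by funext b; simp [pinWeight, hp']
  have hB0 : ∀ {Λ : Finset (ι × Fin k)} (σ : Λ → Bool), 0 ≤
      totalWeight (kTransform μ k hk) (pinWeight σ * spinWeight (i, j) false) := fun σ =>
    totalWeight_nonneg fun _ _ => mul_nonneg (pinWeight_nonneg _ _ _) (spinWeight_nonneg _ _ _ _)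
  have hA0 : 0 ≤ totalWeight (kTransform μ k hk) (pinWeight τ * spinWeight (i, j) true) :=
    totalWeight_nonneg fun _ _ => mul_nonneg (pinWeight_nonneg _ _ _) (spinWeight_nonneg _ _ _ _)
  -- Another site of the block is pinned to `+1`, so `p` cannot be `+1` and the left sides vanish.
  by_cases hv : ∏ l, pinWeight σ (i, l) false = 0
  · rw [totalWeight_kTransform_spin_true hσp, blockWeight_false, hv, mul_zero, zero_mul, zero_mul]
    have := hB0 σ
    constructor <;> positivity
  have hv1 : blockWeight (pinWeight σ) i false = 1 :=
    (blockWeight_false _ i).trans (Finset.prod_eq_one fun l _ =>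
      (pinWeight_eq_zero_or_one σ (i, l) false).resolve_left
        (Finset.prod_ne_zero_iff.1 hv l (Finset.mem_univ l)))
  have hv1' : blockWeight (pinWeight τ) i false = 1 :=
    le_antisymm (blockWeight_le_one (pinWeight_nonneg τ) (pinWeight_le_one τ) i false)
      (hv1 ▸ blockWeight_mono (pinWeight_nonneg σ) hle i false)
  have hupd0 : ∀ {Λ : Finset (ι × Fin k)} (σ : Λ → Bool) (l : ι) (b : Bool),
      0 ≤ Function.update (blockWeight (pinWeight σ)) i 1 l b := by
    intro Λ σ l b
    by_cases hl : l = i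
    · subst hl; simp
    · rw [Function.update_of_ne hl]; exact blockWeight_nonneg (pinWeight_nonneg σ) l b
  obtain ⟨h1, h2⟩ := tilt_ratio_le hζ hμ
    (g := Function.update (blockWeight (pinWeight σ)) i 1)
    (g' := Function.update (blockWeight (pinWeight τ)) i 1) (i := i) (hupd0 σ)
    (fun l b => by
      by_cases hl : l = i
      · subst hl; simp
      · rw [Function.update_of_ne hl, Function.update_of_ne hl]
        exact blockWeight_mono (pinWeight_nonneg σ) hle l b)
    (fun l => by
      by_cases hl : l = i
      · subst hl; simp
      · rw [Function.update_of_ne hl]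
        exact blockWeight_true_le hk (pinWeight_nonneg τ) (fun p => pinWeight_le_one τ p true)
          (fun p => pinWeight_eq_zero_or_one τ p false) l)
    (by simp) (by simp)
  have hf0 : ∀ {Λ : Finset (ι × Fin k)} (σ : Λ → Bool),
      0 ≤ blockWeight (pinWeight σ * spinWeight (i, j) false) i true := fun σ =>
    blockWeight_nonneg (fun p b => mul_nonneg (pinWeight_nonneg _ _ _)
      (spinWeight_nonneg _ _ _ _)) i true
  have hf1 : blockWeight (pinWeight τ * spinWeight (i, j) false) i true ≤ 1 :=
    blockWeight_le_one (fun p b => mul_nonneg (pinWeight_nonneg _ _ _)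
      (spinWeight_nonneg _ _ _ _)) (fun p b => mul_le_one₀ (pinWeight_le_one _ _ _)
      (spinWeight_nonneg _ _ _ _) (by unfold spinWeight; split_ifs <;> norm_num)) i true
  have hZ0 : ∀ {Λ : Finset (ι × Fin k)} (σ : Λ → Bool) (b : Bool), 0 ≤
      totalWeight μ (Function.update (blockWeight (pinWeight σ)) i 1 * spinWeight i b) :=
    fun σ b => totalWeight_nonneg fun l c => mul_nonneg (hupd0 σ l c) (spinWeight_nonneg _ _ _ _)
  have hk1 : (k : ℝ)⁻¹ ≤ 1 := inv_le_one_of_one_le₀ (by exact_mod_cast hk)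
  have hk0 : 0 ≤ (k : ℝ)⁻¹ := by positivity
  rw [totalWeight_kTransform_spin_true hσp, totalWeight_kTransform_spin_true hτp,
    totalWeight_kTransform_spin_false, totalWeight_kTransform_spin_false, hv1, hv1']
  have a0 := hZ0 σ true
  have b0 := hZ0 σ false
  have c0 := hZ0 τ true
  have d0 := hZ0 τ false
  have e0 := hf0 σ
  set a := totalWeight μ (Function.update (blockWeight (pinWeight σ)) i 1 * spinWeight i true)
  set b := totalWeight μ (Function.update (blockWeight (pinWeight σ)) i 1 * spinWeight i false)
  set c := totalWeight μ (Function.update (blockWeight (pinWeight τ)) i 1 * spinWeight i true)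
  set d := totalWeight μ (Function.update (blockWeight (pinWeight τ)) i 1 * spinWeight i false)
  set e := blockWeight (pinWeight σ * spinWeight (i, j) false) i true
  set f := blockWeight (pinWeight τ * spinWeight (i, j) false) i true
  simp only [mul_one, one_mul]
  have hbe : b ≤ e * a + b := le_add_of_nonneg_left (mul_nonneg e0 a0)
  constructor
  · calc (k : ℝ)⁻¹ * a ≤ a := mul_le_of_le_one_left a0 hk1
      _ ≤ ζ * b := h1
      _ ≤ 2 * ζ * b := mul_le_mul_of_nonneg_right (by linarith) b0
      _ ≤ 2 * ζ * (e * a + b) := mul_le_mul_of_nonneg_left hbe (by linarith)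
  -- The two terms a c and a d are bounded by ζ b c each, the first by the absolute and the second
  -- by the relative stability bound; this is the origin of the factor 2.
  · have h3 : a * (f * c + d) ≤ 2 * ζ * c * (e * a + b) := by
      calc a * (f * c + d) ≤ a * (c + d) :=
            mul_le_mul_of_nonneg_left (by linarith [mul_le_of_le_one_left c0 hf1]) a0
        _ = a * c + a * d := by ring
        _ ≤ ζ * b * c + ζ * c * b := add_le_add (mul_le_mul_of_nonneg_right h1 c0) h2
        _ = 2 * ζ * c * b := by ring
        _ ≤ 2 * ζ * c * (e * a + b) := mul_le_mul_of_nonneg_left hbe (by positivity)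
    calc (k : ℝ)⁻¹ * a * (f * c + d) = (k : ℝ)⁻¹ * (a * (f * c + d)) := by ring
      _ ≤ (k : ℝ)⁻¹ * (2 * ζ * c * (e * a + b)) := mul_le_mul_of_nonneg_left h3 hk0
      _ = 2 * ζ * ((k : ℝ)⁻¹ * c) * (e * a + b) := by ring

theorem marginallyStable_kTransform {ζ : ℝ} (hζ : 0 < ζ)
    (hμ : ∀ (lam : ι → ℝ) (hlam : ∀ i, 0 < lam i), (∀ i, lam i ≤ 1) →
      MarginallyStable ζ (magnetize lam hlam μ)) :
    MarginallyStable (2 * ζ) (kTransform μ k hk) := by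
  intro p S Λ hS hp σ hσ
  have hζ2 : 0 < 2 * ζ := by linarith
  have hN := isTilt_pin σ hσ
  have hN' := isTilt_pin _ (restrict₂_mem_marginalOn hS hσ)
  obtain ⟨h1, h2⟩ := kTransform_ratio_le (hk := hk) hζ hμ hS hp σ
  have h3 := (kTransform_ratio_le (hk := hk) hζ hμ (subset_refl S) (fun hc => hp (hS hc))
    (Finset.restrict₂ (π := fun _ => Bool) hS σ)).1
  rw [← ratio_le_iff_of_isTilt hN (pinWeight_nonneg _)] at h1
  rw [← ratio_le_iff_of_isTilt hN' (pinWeight_nonneg _)] at h3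
  rw [← ratio_le_mul_iff_of_isTilt hN hN' (pinWeight_nonneg _) (pinWeight_nonneg _)] at h2
  exact ⟨(marginalRatio_le_iff hζ2 p).2 h1, (marginalRatio_le_mul_iff hζ2
    (totalWeight_spin_false_pos h1) (totalWeight_spin_false_pos h3)).2 h2⟩

end Main

end SpinDist

end

theorem lemma2p7 (d : SpinDist.Diagonal) {n : ℕ} (μ : PMF (Fin n → Bool)) (η ε ζ : ℝ)
    (hμ : SpinDist.StrongCondition d η ε ζ μ) :
    ∀ (k : ℕ) (hk : 1 ≤ k), 10 * (1 + ε) * (1 + ζ) ≤ (k : ℝ) →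
      SpinDist.WeakCondition d (2 * η + 5) ε (2 * ζ) (SpinDist.kTransform μ k hk) := by
  intro k hk _
  have hη := hμ.one_lt_eta
  have hε := hμ.eps_pos
  have hζ := hμ.one_lt_zeta
  refine ⟨by linarith, hε, by linarith, fun lam hlam hle => ?_,
    SpinDist.marginallyStable_kTransform (by linarith) hμ.marginallyStable⟩
  -- Any θ > η would be admissible; θ = 2η + 3 makes θ + 2 equal to the claimed constant.
  have h := SpinDist.spectrallyIndependent_kTransform (hk := hk) d (by linarith)
    (show η < 2 * η + 3 by linarith) (by linarith) hμ.spectrallyIndependent lam hlam hle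
  rwa [show 2 * η + 3 + 2 = 2 * η + 5 by ring] at h
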